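/- Let $N\ge 1$ be an integer. For $0<\alpha<1$ let $h_\alpha$ be the probability density on $(0,\infty)$ with $\int_0^\infty e^{z\theta}h_\alpha(\theta)\,d\theta=\sum_{k\ge0} z^k/\Gamma(\alpha k+1)$ for all $z\in\mathbb C$. For $t>0$ and a nonnegative measure $\mu$ on $\mathbb R^N$ put $$e^{t\Delta}\mu(x)=\int_{\mathbb R^N}(4\pi t)^{-N/2}e^{-|x-y|^2/(4t)}\,d\mu(y),\quad P_\alpha(t)\mu=\int_0^\infty h_\alpha(\theta)\,e^{t^\alpha\theta\Delta}\mu\,d\theta,\quad S_\alpha(t)\mu=\int_0^\infty\theta h_\alpha(\theta)\,e^{t^\alpha\theta\Delta}\mu\,d\theta,$$ and identify a nonnegative measurable function $\phi$ with the measure $\phi\,dx$. For $p>1$ and $0<T<\infty$, a solution in $[0,T]\times\mathbb R^N$ of $$\partial_t^\alpha u-\Delta u=u^p,\qquad u(0)=\mu,\qquad(\ast)$$ where $\partial_t^\alpha$ is the Caputo derivative, is a nonnegative measurable function $u$ on $(0,T]\times\mathbb R^N$ such that, for almost all $t\in(0,T]$ and $x\in\mathbb R^N$, $$\infty>u(t,x)=[P_\alpha(t)\mu](x)+\alpha\int_0^t(t-s)^{\alpha-1}[S_\alpha(t-s)u(s)^p](x)\,ds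 .$$ **Theorem.** Let $p>p_F:=1+2/N$ and let $1<r<\infty$ satisfy $\frac{2r}{p-1}<N$. Then for every $\alpha\in(0,1)$ there is a constant $\gamma_3=\gamma_3(N,p,r,\alpha)>0$, such that for every $T>0$ and every nonnegative measurable function $\mu$ on $\mathbb R^N$ with $$\sup_{z\in\mathbb R^N}\Big(\int_{B(z,\sigma)}\mu(y)^r\,dy\Big)^{1/r}\le\gamma_3\,\sigma^{\frac Nr-\frac2{p-1}}\qquad\text{for all }\sigma\in(0,T^{\alpha/2}],$$ problem $(\ast)$ possesses a solution in $[0,T]\times\mathbb R^N$. Moreover, the constants can be chosen so that $\limsup_{\alpha\to1^-}\gamma_3(N,p,r,\alpha)\in(0,\infty)$. -/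

import Mathlib

open MeasureTheory Set Filter Topology
open scoped ENNReal

namespace TimeFractional

/-! ### The probability density `h_α` -/

/-- The function `A(φ) = sin((1-α)φ) (sin αφ)^{α/(1-α)} / (sin φ)^{1/(1-α)}`, `0 < φ < π`, of
Zolotarev's integral representation of the one-sided `α`-stable density. -/
noncomputable def zolotarevA (α φ : ℝ) : ℝ :=
  Real.sin ((1 - α) * φ) * Real.sin (α * φ) ^ (α / (1 - α)) / Real.sin φ ^ (1 / (1 - α))

/-- The probability density `h_α` on `(0,∞)`, `0 < α < 1` (the M-Wright function), built explicitly: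
`h_α(θ) = (π(1-α))⁻¹ θ^{α/(1-α)} ∫_0^π A(φ) exp(-A(φ) θ^{1/(1-α)}) dφ`.
Equivalently `h_α(θ) = α⁻¹ θ^{-1-1/α} f_α(θ^{-1/α})` with `f_α` the one-sided `α`-stable density.
That this is the right function is proved below: it is positive (`hDensity_pos`), its moments are
`∫_0^∞ θ^n h_α(θ) dθ = n! / Γ(αn+1)`, in particular its mass is `1` (`lintegral_pow_mul_hDensity`,
`lintegral_hDensity`), and `∫_0^∞ e^{zθ} h_α(θ) dθ` is the Mittag-Leffler function `E_{α,1}(z)`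
(`lintegral_exp_mul_hDensity`); these moments determine the density up to null sets. -/
noncomputable def hDensity (α θ : ℝ) : ℝ :=
  1 / (Real.pi * (1 - α)) * θ ^ (α / (1 - α)) *
    ∫ φ in (0 : ℝ)..Real.pi,
      zolotarevA α φ * Real.exp (-(zolotarevA α φ * θ ^ (1 / (1 - α))))

/-! ### Operators and solutions

Everything below is nonnegative, so all integrals are taken in `[0,∞]`; there is no integrability
condition and no default value involved. -/

/-- The heat kernel `G(t,x) = (4πt)^{-N/2} exp(-|x|²/(4t))` on `ℝ^N`. -/
noncomputable def heatKernel {N : ℕ} (t : ℝ) (x : EuclideanSpace ℝ (Fin N)) : ℝ :=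
  1 / (4 * Real.pi * t) ^ ((N : ℝ) / 2) * Real.exp (-(‖x‖ ^ 2 / (4 * t)))

/-- `[e^{tΔ} μ](x) = ∫ G(t, x - y) dμ(y)` for a nonnegative measure `μ`. -/
noncomputable def heatSemigroup {N : ℕ} (t : ℝ) (μ : Measure (EuclideanSpace ℝ (Fin N)))
    (x : EuclideanSpace ℝ (Fin N)) : ℝ≥0∞ :=
  ∫⁻ y, ENNReal.ofReal (heatKernel t (x - y)) ∂μ

/-- `[P_α(t) μ](x) = ∫_0^∞ h_α(θ) [e^{t^α θ Δ} μ](x) dθ`. -/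
noncomputable def opP {N : ℕ} (α t : ℝ) (μ : Measure (EuclideanSpace ℝ (Fin N)))
    (x : EuclideanSpace ℝ (Fin N)) : ℝ≥0∞ :=
  ∫⁻ θ in Ioi (0 : ℝ), ENNReal.ofReal (hDensity α θ) * heatSemigroup (t ^ α * θ) μ x

/-- `[S_α(t) μ](x) = ∫_0^∞ θ h_α(θ) [e^{t^α θ Δ} μ](x) dθ`. -/
noncomputable def opS {N : ℕ} (α t : ℝ) (μ : Measure (EuclideanSpace ℝ (Fin N)))
    (x : EuclideanSpace ℝ (Fin N)) : ℝ≥0∞ :=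
  ∫⁻ θ in Ioi (0 : ℝ), ENNReal.ofReal (θ * hDensity α θ) * heatSemigroup (t ^ α * θ) μ x

/-- `u` is a solution in `[0,T] × ℝ^N` of `∂_t^α u - Δu = u^p`, `u(0) = μ`, where `μ` is a nonnegative
measure: `u` is nonnegative and measurable, and for almost all `t ∈ (0,T]` and `x ∈ ℝ^N`
`∞ > u(t,x) = [P_α(t)μ](x) + α ∫_0^t (t-s)^{α-1} [S_α(t-s) u(s)^p](x) ds`,
where the function `u(s)^p` is identified with the measure `u(s)^p dx`. The values of `u` outside
`(0,T] × ℝ^N` play no role. -/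
def IsSolution {N : ℕ} (α p T : ℝ) (μ : Measure (EuclideanSpace ℝ (Fin N)))
    (u : ℝ → EuclideanSpace ℝ (Fin N) → ℝ≥0∞) : Prop :=
  Measurable (Function.uncurry u) ∧
  ∀ᵐ z : ℝ × EuclideanSpace ℝ (Fin N) ∂((volume.restrict (Ioc 0 T)).prod volume),
    u z.1 z.2 < ∞ ∧
    u z.1 z.2 = opP α z.1 μ z.2 +
      ENNReal.ofReal α * ∫⁻ s in Ioo 0 z.1, ENNReal.ofReal ((z.1 - s) ^ (α - 1)) *
        opS α (z.1 - s) (volume.withDensity fun y => u s y ^ p) z.2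

/-! ### Verification of the properties of `h_α`

With `w = (sin αφ / sin (1-α)φ) e^{iφ}` the number `A(φ)^{-(1-α)} = (1+w) w^{-α}` is real; expanding
`(1+w)^n` and integrating over `0 < φ < π` gives the moments. -/

lemma inv_Gamma_eq (x : ℝ) : (Real.Gamma x)⁻¹ = x * (Real.Gamma (x + 1))⁻¹ := by
  rcases eq_or_ne x 0 with rfl | h
  · simp
  · rw [Real.Gamma_add_one h, mul_inv, mul_inv_cancel_left₀ h]

lemma sum_choose_mul_sinc (n : ℕ) (x : ℝ) :
    ∑ k ∈ Finset.range (n + 1), (n.choose k : ℝ) * Real.sinc (Real.pi * (k - x)) =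
      n.factorial * (Real.Gamma (1 + x))⁻¹ * (Real.Gamma (1 + n - x))⁻¹ := by
  induction n generalizing x with
  | zero =>
    rcases eq_or_ne x 0 with rfl | h
    · simp
    · have h1 : Real.pi * x ≠ 0 := mul_ne_zero Real.pi_ne_zero h
      have := Real.Gamma_mul_Gamma_one_sub x
      rw [add_comm 1 x, Real.Gamma_add_one h]
      simp only [zero_add, Finset.range_one, Finset.sum_singleton, Nat.choose_self, Nat.cast_one,
        one_mul, Nat.cast_zero, zero_sub, mul_neg, Real.sinc_neg, Real.sinc_of_ne_zero h1,
        Nat.factorial_zero, add_zero]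
      rw [← mul_inv, mul_assoc, this, ← inv_div]
      field_simp
  | succ n ih =>
    have := Finset.sum_choose_succ_mul (fun i _ => Real.sinc (Real.pi * (i - x))) n
    rw [this, ih x]
    have h2 := ih (x - 1)
    have h3 : ∀ k : ℕ, Real.pi * ((k : ℝ) - (x - 1)) = Real.pi * (((k + 1 : ℕ) : ℝ) - x) := by
      intro k; push_cast; ring
    simp only [h3] at h2
    rw [h2, Nat.factorial_succ]
    have e1 := inv_Gamma_eq x
    have e2 := inv_Gamma_eq (1 + n - x)
    rw [show 1 + (x - 1) = x by ring, show 1 + (n : ℝ) - (x - 1) = 1 + n - x + 1 by ring, e1, e2,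
      show (1 : ℝ) + ((n + 1 : ℕ) : ℝ) - x = 1 + n - x + 1 by push_cast; ring, add_comm 1 x]
    push_cast
    ring

lemma sum_rot (n : ℕ) {α φ : ℝ} (h0 : 0 < α) (h1 : α < 1) (hφ : 0 < φ) (hφ' : φ < Real.pi)
    (c : ℝ) :
    ∑ k ∈ Finset.range (n + 1), (n.choose k : ℝ) *
      ((Real.sin (α * φ) / Real.sin ((1 - α) * φ)) ^ ((k : ℝ) - α * n) *
        (Real.cos ((k - α * n) * φ) + c * Real.sin ((k - α * n) * φ))) =
      (Real.sin φ / Real.sin ((1 - α) * φ) *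
        (Real.sin (α * φ) / Real.sin ((1 - α) * φ)) ^ (-α)) ^ n := by
  have s1 : 0 < Real.sin (α * φ) :=
    Real.sin_pos_of_pos_of_lt_pi (by positivity) (by nlinarith)
  have s2 : 0 < Real.sin ((1 - α) * φ) :=
    Real.sin_pos_of_pos_of_lt_pi (mul_pos (by linarith) hφ) (by nlinarith)
  set ρ := Real.sin (α * φ) / Real.sin ((1 - α) * φ) with hρ
  set m := Real.sin φ / Real.sin ((1 - α) * φ) with hm
  have ρ0 : 0 < ρ := div_pos s1 s2
  have hw : (1 : ℂ) + ρ * Complex.exp (φ * Complex.I) = m * Complex.exp (α * φ * Complex.I) := by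
    have hs : Real.sin ((1 - α) * φ) =
        Real.sin φ * Real.cos (α * φ) - Real.cos φ * Real.sin (α * φ) := by
      rw [show (1 - α) * φ = φ - α * φ by ring, Real.sin_sub]
    rw [show (α : ℂ) * φ = ((α * φ : ℝ) : ℂ) by push_cast; rfl]
    apply Complex.ext
    · simp only [Complex.add_re, Complex.one_re, Complex.re_ofReal_mul, Complex.exp_ofReal_mul_I_re]
      rw [hρ, hm, div_mul_eq_mul_div, div_mul_eq_mul_div, eq_div_iff s2.ne', add_mul,
        div_mul_cancel₀ _ s2.ne', hs]
      ring
    · simp only [Complex.add_im, Complex.one_im, Complex.im_ofReal_mul, Complex.exp_ofReal_mul_I_im]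
      rw [hρ, hm]
      field_simp
      ring
  have key : ∑ k ∈ Finset.range (n + 1), (n.choose k : ℂ) *
      (((ρ ^ ((k : ℝ) - α * n) : ℝ) : ℂ) * Complex.exp (((k - α * n) * φ : ℝ) * Complex.I)) =
      (((m * ρ ^ (-α)) ^ n : ℝ) : ℂ) := by
    have e := congrArg (fun z : ℂ => z ^ n * ((ρ ^ (-(α * n)) : ℝ) : ℂ) *
      Complex.exp (((-(α * n)) * φ : ℝ) * Complex.I)) hw
    simp only [add_comm (1 : ℂ), add_pow, Finset.sum_mul] at e
    have r : ((m : ℂ) * Complex.exp (α * φ * Complex.I)) ^ n * ((ρ ^ (-(α * n)) : ℝ) : ℂ) *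
      Complex.exp (((-(α * n)) * φ : ℝ) * Complex.I) = (((m * ρ ^ (-α)) ^ n : ℝ) : ℂ) := by
      rw [mul_pow, ← Complex.exp_nat_mul]
      have : Complex.exp (n * (α * φ * Complex.I)) * Complex.exp (((-(α * n)) * φ : ℝ) * Complex.I)
          = 1 := by
        rw [← Complex.exp_add, ← Complex.exp_zero]; congr 1; push_cast; ring
      have e3 : ρ ^ (-(α * n)) = (ρ ^ (-α)) ^ n := by
        rw [← Real.rpow_natCast, ← Real.rpow_mul ρ0.le]; congr 1; ring
      rw [e3]
      push_cast
      push_cast at this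
      linear_combination (m : ℂ) ^ n * ((ρ ^ (-α) : ℝ) : ℂ) ^ n * this
    rw [r] at e
    rw [← e]
    refine Finset.sum_congr rfl fun k _ => ?_
    have e3 : ρ ^ ((k : ℝ) - α * n) = ρ ^ k * ρ ^ (-(α * n)) := by
      rw [← Real.rpow_natCast, ← Real.rpow_add ρ0]; congr 1
    have e4 : Complex.exp (((k - α * n) * φ : ℝ) * Complex.I) =
        Complex.exp (φ * Complex.I) ^ k * Complex.exp (((-(α * n)) * φ : ℝ) * Complex.I) := by
      rw [← Complex.exp_nat_mul, ← Complex.exp_add]; congr 1; push_cast; ring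
    rw [e3, e4]
    push_cast
    ring
  have kr := congrArg Complex.re key
  have ki := congrArg Complex.im key
  simp only [Complex.re_sum, Complex.im_sum, ← Complex.ofReal_natCast, Complex.re_ofReal_mul,
    Complex.im_ofReal_mul, Complex.exp_ofReal_mul_I_re, Complex.exp_ofReal_mul_I_im,
    Complex.ofReal_re, Complex.ofReal_im] at kr ki
  rw [← kr, ← add_zero (∑ k ∈ Finset.range (n + 1), _ * (_ * Real.cos _)),
    ← mul_zero c, ← ki, Finset.mul_sum, ← Finset.sum_add_distrib]
  refine Finset.sum_congr rfl fun k _ => by ring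

lemma measurable_zolotarevA (α : ℝ) : Measurable (zolotarevA α) := by
  unfold zolotarevA; fun_prop

lemma sin_pos_aux {c φ : ℝ} (h0 : 0 < c) (h1 : c < 1) (hφ : 0 < φ) (hφ' : φ < Real.pi) :
    0 < Real.sin (c * φ) :=
  Real.sin_pos_of_pos_of_lt_pi (by positivity) (by nlinarith)

lemma mul_sin_le_aux {c φ : ℝ} (h0 : 0 < c) (h1 : c < 1) (hφ : 0 < φ) (hφ' : φ < Real.pi) :
    c * Real.sin φ ≤ Real.sin (c * φ) := by
  have := strictConcaveOn_sin_Icc.concaveOn.2 ⟨le_rfl, Real.pi_pos.le⟩ ⟨hφ.le, hφ'.le⟩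
    (sub_nonneg.2 h1.le) h0.le (by ring)
  simpa using this

lemma zolotarevA_pos {α φ : ℝ} (h0 : 0 < α) (h1 : α < 1) (hφ : 0 < φ) (hφ' : φ < Real.pi) :
    0 < zolotarevA α φ := by
  have s1 := sin_pos_aux h0 h1 hφ hφ'
  have s2 := sin_pos_aux (c := 1 - α) (by linarith) (by linarith) hφ hφ'
  have s3 := Real.sin_pos_of_pos_of_lt_pi hφ hφ'
  unfold zolotarevA; positivity

lemma zolotarevA_rpow {α φ : ℝ} (h0 : 0 < α) (h1 : α < 1) (hφ : 0 < φ) (hφ' : φ < Real.pi) :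
    zolotarevA α φ ^ (-(1 - α)) = Real.sin φ / Real.sin ((1 - α) * φ) *
        (Real.sin (α * φ) / Real.sin ((1 - α) * φ)) ^ (-α) := by
  have s1 := sin_pos_aux h0 h1 hφ hφ'
  have s2 := sin_pos_aux (c := 1 - α) (by linarith) (by linarith) hφ hφ'
  have s3 := Real.sin_pos_of_pos_of_lt_pi hφ hφ'
  have ha : (1 - α) ≠ 0 := by linarith
  unfold zolotarevA
  rw [Real.div_rpow (by positivity) (by positivity), Real.mul_rpow s2.le (by positivity),
    ← Real.rpow_mul s1.le, ← Real.rpow_mul s3.le, Real.div_rpow s1.le s2.le,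
    show α / (1 - α) * -(1 - α) = -α by field_simp,
    show 1 / (1 - α) * -(1 - α) = -1 by field_simp, Real.rpow_neg_one]
  rw [show -(1 - α) = -1 - -α by ring, Real.rpow_sub s2, Real.rpow_neg_one]
  field_simp

lemma zolotarevA_rpow_le {α φ : ℝ} (h0 : 0 < α) (h1 : α < 1) (hφ : 0 < φ) (hφ' : φ < Real.pi) :
    zolotarevA α φ ^ (-(1 - α)) ≤ 1 / (α * (1 - α)) := by
  have s1 := sin_pos_aux h0 h1 hφ hφ'
  have s2 := sin_pos_aux (c := 1 - α) (by linarith) (by linarith) hφ hφ'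
  have s3 := Real.sin_pos_of_pos_of_lt_pi hφ hφ'
  have ha : 0 < 1 - α := by linarith
  have m1 : Real.sin φ / Real.sin (α * φ) ≤ 1 / (α * (1 - α)) := by
    rw [div_le_div_iff₀ s1 (by positivity)]
    nlinarith [mul_sin_le_aux h0 h1 hφ hφ', mul_pos h0 (mul_pos s3 h0)]
  have m2 : Real.sin φ / Real.sin ((1 - α) * φ) ≤ 1 / (α * (1 - α)) := by
    rw [div_le_div_iff₀ s2 (by positivity)]
    nlinarith [mul_sin_le_aux ha (by linarith) hφ hφ', mul_pos ha (mul_pos s3 ha)]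
  have e : zolotarevA α φ ^ (-(1 - α)) =
      (Real.sin φ / Real.sin (α * φ)) ^ α * (Real.sin φ / Real.sin ((1 - α) * φ)) ^ (1 - α) := by
    rw [zolotarevA_rpow h0 h1 hφ hφ', Real.div_rpow s1.le s2.le, Real.div_rpow s3.le s1.le,
      Real.div_rpow s3.le s2.le, Real.rpow_neg s1.le, Real.rpow_neg s2.le, Real.rpow_sub s2,
      Real.rpow_sub s3, Real.rpow_one, Real.rpow_one]
    field_simp
  rw [e]
  have c0 : 0 < 1 / (α * (1 - α)) := by positivity
  calc _ ≤ (1 / (α * (1 - α))) ^ α * (1 / (α * (1 - α))) ^ (1 - α) := by gcongr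
    _ = _ := by rw [← Real.rpow_add c0]; simp

lemma integral_zolotarevA_rpow {α : ℝ} (h0 : 0 < α) (h1 : α < 1) (n : ℕ) :
    IntervalIntegrable (fun φ => (zolotarevA α φ ^ (-(1 - α))) ^ n) volume 0 Real.pi ∧
    ∫ φ in (0 : ℝ)..Real.pi, (zolotarevA α φ ^ (-(1 - α))) ^ n =
      Real.pi * (n.factorial * (Real.Gamma (1 + α * n))⁻¹ * (Real.Gamma (1 + n - α * n))⁻¹) := by
  have ha : 0 < 1 - α := by linarith
  have hint : IntervalIntegrable (fun φ => (zolotarevA α φ ^ (-(1 - α))) ^ n) volume 0 Real.pi := by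
    rw [intervalIntegrable_iff_integrableOn_Ioo_of_le Real.pi_pos.le]
    refine Measure.integrableOn_of_bounded (M := (1 / (α * (1 - α))) ^ n) (by simp)
      (((measurable_zolotarevA α).pow_const _).pow_const n).aestronglyMeasurable ?_
    filter_upwards [ae_restrict_mem measurableSet_Ioo] with φ hφ
    have := zolotarevA_pos h0 h1 hφ.1 hφ.2
    rw [Real.norm_of_nonneg (by positivity)]
    exact pow_le_pow_left₀ (by positivity) (zolotarevA_rpow_le h0 h1 hφ.1 hφ.2) n
  refine ⟨hint, ?_⟩
  set ρ : ℝ → ℝ := fun φ => Real.sin (α * φ) / Real.sin ((1 - α) * φ) with hρ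
  set F : ℝ → ℝ := fun φ => ∑ k ∈ Finset.range (n + 1), (n.choose k : ℝ) *
    (ρ φ ^ ((k : ℝ) - α * n) * (φ * Real.sinc ((k - α * n) * φ))) with hF
  have hderiv : ∀ φ ∈ Ioo 0 Real.pi, HasDerivAt F ((zolotarevA α φ ^ (-(1 - α))) ^ n) φ := by
    intro φ hφ
    have s1 := sin_pos_aux h0 h1 hφ.1 hφ.2
    have s2 := sin_pos_aux (c := 1 - α) ha (by linarith) hφ.1 hφ.2
    have ρ0 : 0 < ρ φ := div_pos s1 s2
    obtain ⟨ρ', hρ'⟩ : ∃ d, HasDerivAt ρ d φ := by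
      have : DifferentiableAt ℝ ρ φ :=
        (show DifferentiableAt ℝ (fun φ => Real.sin (α * φ)) φ by fun_prop).fun_div
          (show DifferentiableAt ℝ (fun φ => Real.sin ((1 - α) * φ)) φ by fun_prop) s2.ne'
      exact ⟨_, this.hasDerivAt⟩
    rw [zolotarevA_rpow h0 h1 hφ.1 hφ.2, ← sum_rot n h0 h1 hφ.1 hφ.2 (ρ' / ρ φ)]
    refine HasDerivAt.fun_sum fun k _ => HasDerivAt.const_mul _ ?_
    generalize (k : ℝ) - α * n = s
    change HasDerivAt _ (ρ φ ^ s * _) φ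
    rcases eq_or_ne s 0 with rfl | hs
    · simpa using hasDerivAt_id' φ
    · have d1 : HasDerivAt (fun x => ρ x ^ s * (Real.sin (s * x) / s))
          (ρ' * s * ρ φ ^ (s - 1) * (Real.sin (s * φ) / s) +
            ρ φ ^ s * (Real.cos (s * φ) * (s * 1) / s)) φ :=
        (hρ'.rpow_const (Or.inl ρ0.ne')).mul
          ((((hasDerivAt_id φ).const_mul s).sin).div_const s)
      have e : (fun x => ρ x ^ s * (x * Real.sinc (s * x))) =
          fun x => ρ x ^ s * (Real.sin (s * x) / s) := by
        funext x
        rcases eq_or_ne x 0 with rfl | hx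
        · simp
        · rw [Real.sinc_of_ne_zero (mul_ne_zero hs hx)]; field_simp
      rw [e]
      convert d1 using 1
      rw [Real.rpow_sub_one ρ0.ne']
      field_simp
      ring
  have hlim0 : Tendsto ρ (𝓝[>] 0) (𝓝 (α / (1 - α))) := by
    have t : ∀ c : ℝ, c ≠ 0 → Tendsto (fun φ : ℝ => Real.sinc (c * φ)) (𝓝[>] 0) (𝓝 1) := by
      intro c _
      have : Continuous (fun φ : ℝ => Real.sinc (c * φ)) := by
        have := Real.continuous_sinc; fun_prop
      simpa using (this.tendsto 0).mono_left nhdsWithin_le_nhds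
    have t2 := ((t α h0.ne').const_mul α).div ((t _ ha.ne').const_mul (1 - α)) (by simpa using ha.ne')
    simp only [mul_one] at t2
    refine t2.congr' ?_
    filter_upwards [self_mem_nhdsWithin] with φ (hφ : 0 < φ)
    simp only [Pi.div_apply, hρ]
    rw [Real.sinc_of_ne_zero (by positivity), Real.sinc_of_ne_zero (by positivity)]
    field_simp
  have hc : ∀ s : ℝ, Continuous fun φ : ℝ => φ * Real.sinc (s * φ) := by
    intro s; have := Real.continuous_sinc; fun_prop
  have hF0 : Tendsto F (𝓝[>] 0) (𝓝 0) := by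
    have : Tendsto F (𝓝[>] 0) (𝓝 (∑ k ∈ Finset.range (n + 1), (n.choose k : ℝ) *
        ((α / (1 - α)) ^ ((k : ℝ) - α * n) * (0 * Real.sinc ((k - α * n) * 0))))) := by
      refine tendsto_finsetSum _ fun k _ => Tendsto.const_mul _ (Tendsto.mul ?_ ?_)
      · exact hlim0.rpow_const (Or.inl (by positivity))
      · exact ((hc _).tendsto 0).mono_left nhdsWithin_le_nhds
    simpa using this
  have hρπ : Tendsto ρ (𝓝[<] Real.pi) (𝓝 1) := by
    have s2 : 0 < Real.sin (α * Real.pi) :=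
      Real.sin_pos_of_pos_of_lt_pi (by positivity) (by nlinarith [Real.pi_pos])
    have e : Real.sin ((1 - α) * Real.pi) = Real.sin (α * Real.pi) := by
      rw [← Real.sin_pi_sub]; congr 1; ring
    have : ContinuousAt ρ Real.pi := by
      apply ContinuousAt.div (by fun_prop) (by fun_prop)
      rw [e]; exact s2.ne'
    have h := this.tendsto
    rw [show ρ Real.pi = 1 by simp only [hρ]; rw [e, div_self s2.ne']] at h
    exact h.mono_left nhdsWithin_le_nhds
  have hFπ : Tendsto F (𝓝[<] Real.pi) (𝓝 (∑ k ∈ Finset.range (n + 1), (n.choose k : ℝ) *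
        (1 ^ ((k : ℝ) - α * n) * (Real.pi * Real.sinc ((k - α * n) * Real.pi))))) := by
    refine tendsto_finsetSum _ fun k _ => Tendsto.const_mul _ (Tendsto.mul ?_ ?_)
    · exact hρπ.rpow_const (Or.inl (by positivity))
    · exact ((hc _).tendsto _).mono_left nhdsWithin_le_nhds
  rw [intervalIntegral.integral_eq_sub_of_hasDerivAt_of_tendsto Real.pi_pos hderiv hint hF0 hFπ,
    ← sum_choose_mul_sinc, Finset.mul_sum, sub_zero]
  refine Finset.sum_congr rfl fun k _ => ?_
  rw [Real.one_rpow, mul_comm ((k : ℝ) - α * n)]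
  ring

lemma hDensity_integrable {α θ : ℝ} (h0 : 0 < α) (h1 : α < 1) (hθ : 0 < θ) :
    IntervalIntegrable (fun φ => zolotarevA α φ *
      Real.exp (-(zolotarevA α φ * θ ^ (1 / (1 - α))))) volume 0 Real.pi := by
  rw [intervalIntegrable_iff_integrableOn_Ioo_of_le Real.pi_pos.le]
  have hA := measurable_zolotarevA α
  have hc : 0 < θ ^ (1 / (1 - α)) := Real.rpow_pos_of_pos hθ _
  refine Measure.integrableOn_of_bounded (M := 1 / θ ^ (1 / (1 - α))) (by simp)
    (by fun_prop) ?_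
  filter_upwards [ae_restrict_mem measurableSet_Ioo] with φ hφ
  have := zolotarevA_pos h0 h1 hφ.1 hφ.2
  rw [Real.norm_of_nonneg (by positivity), le_div_iff₀ hc, Real.exp_neg]
  have h := Real.add_one_le_exp (zolotarevA α φ * θ ^ (1 / (1 - α)))
  rw [mul_right_comm, ← div_eq_mul_inv, div_le_one (Real.exp_pos _)]
  linarith

/-- `h_α > 0` on `(0,∞)`. -/
theorem hDensity_pos {α θ : ℝ} (h0 : 0 < α) (h1 : α < 1) (hθ : 0 < θ) : 0 < hDensity α θ := by
  have ha : 0 < 1 - α := by linarith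
  have : 0 < ∫ φ in (0 : ℝ)..Real.pi,
      zolotarevA α φ * Real.exp (-(zolotarevA α φ * θ ^ (1 / (1 - α)))) :=
    intervalIntegral.intervalIntegral_pos_of_pos_on (hDensity_integrable h0 h1 hθ)
      (fun φ hφ => mul_pos (zolotarevA_pos h0 h1 hφ.1 hφ.2) (Real.exp_pos _)) Real.pi_pos
  unfold hDensity
  have := Real.pi_pos
  positivity

/-- The moments of `h_α`: `∫_0^∞ θ^n h_α(θ) dθ = n! / Γ(αn+1)`. -/
theorem lintegral_pow_mul_hDensity {α : ℝ} (h0 : 0 < α) (h1 : α < 1) (n : ℕ) :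
    ∫⁻ θ in Ioi (0 : ℝ), ENNReal.ofReal (θ ^ n * hDensity α θ) =
      ENNReal.ofReal (n.factorial / Real.Gamma (α * n + 1)) := by
  have ha : 0 < 1 - α := by linarith
  have hA := measurable_zolotarevA α
  have hpi := Real.pi_pos
  have hG : 0 < Real.Gamma (n * (1 - α) + 1) := Real.Gamma_pos_of_pos (by positivity)
  let f : ℝ → ℝ → ℝ := fun θ φ => 1 / (Real.pi * (1 - α)) * zolotarevA α φ *
    (θ ^ (n + α / (1 - α)) * Real.exp (-zolotarevA α φ * θ ^ (1 / (1 - α))))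
  have e1 : ∀ θ ∈ Ioi (0 : ℝ), ENNReal.ofReal (θ ^ n * hDensity α θ) =
      ∫⁻ φ in Ioo 0 Real.pi, ENNReal.ofReal (f θ φ) := by
    intro θ (hθ : 0 < θ)
    have e : θ ^ n * hDensity α θ = ∫ φ in Ioo 0 Real.pi, f θ φ := by
      unfold hDensity
      rw [intervalIntegral.integral_of_le hpi.le, integral_Ioc_eq_integral_Ioo, ← mul_assoc,
        ← integral_const_mul]
      refine integral_congr_ae (Eventually.of_forall fun φ => ?_)
      simp only [f, Real.rpow_add hθ, Real.rpow_natCast]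
      rw [neg_mul]
      ring
    rw [e, ofReal_integral_eq_lintegral_ofReal]
    · have := ((intervalIntegrable_iff_integrableOn_Ioo_of_le hpi.le).1
        (hDensity_integrable h0 h1 hθ)).const_mul
          (1 / (Real.pi * (1 - α)) * θ ^ (n + α / (1 - α)))
      refine this.congr (Eventually.of_forall fun φ => ?_)
      simp only [f]
      rw [neg_mul]
      ring
    · filter_upwards [ae_restrict_mem measurableSet_Ioo] with φ hφ
      have := zolotarevA_pos h0 h1 hφ.1 hφ.2
      simp only [f, Pi.zero_apply]
      positivity
  rw [setLIntegral_congr_fun measurableSet_Ioi e1, lintegral_lintegral_swap]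
  swap
  · refine Measurable.aemeasurable ?_
    simp only [f, Function.uncurry_def]
    fun_prop
  have e2 : ∀ φ ∈ Ioo 0 Real.pi, ∫⁻ θ in Ioi (0 : ℝ), ENNReal.ofReal (f θ φ) =
      ENNReal.ofReal (1 / Real.pi * Real.Gamma (n * (1 - α) + 1) *
        (zolotarevA α φ ^ (-(1 - α))) ^ n) := by
    intro φ hφ
    have hA0 := zolotarevA_pos h0 h1 hφ.1 hφ.2
    have hp : 0 < 1 / (1 - α) := by positivity
    have hq : (-1 : ℝ) < n + α / (1 - α) := by
      have : (0 : ℝ) ≤ n + α / (1 - α) := by positivity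
      linarith
    have I := integral_rpow_mul_exp_neg_mul_rpow hp hq hA0
    have q1 : (n + α / (1 - α) + 1) / (1 / (1 - α)) = n * (1 - α) + 1 := by field_simp; ring
    have hi : IntegrableOn (fun θ : ℝ => θ ^ (n + α / (1 - α)) *
        Real.exp (-zolotarevA α φ * θ ^ (1 / (1 - α)))) (Ioi 0) := by
      by_contra hcon
      rw [integral_undef hcon, q1] at I
      have : 0 < zolotarevA α φ ^ (-(n + α / (1 - α) + 1) / (1 / (1 - α))) := by positivity
      have : 0 < zolotarevA α φ ^ (-(n + α / (1 - α) + 1) / (1 / (1 - α))) *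
        (1 / (1 / (1 - α))) * Real.Gamma (n * (1 - α) + 1) := by positivity
      linarith
    simp only [f]
    rw [← ofReal_integral_eq_lintegral_ofReal (hi.const_mul _), integral_const_mul, I, neg_div, q1]
    · congr 1
      rw [← Real.rpow_natCast, ← Real.rpow_mul hA0.le,
        show -((n : ℝ) * (1 - α) + 1) = -(1 - α) * n - 1 by ring, Real.rpow_sub_one hA0.ne']
      field_simp
    · filter_upwards [ae_restrict_mem measurableSet_Ioi] with θ (hθ : 0 < θ)
      simp only [Pi.zero_apply]
      positivity
  obtain ⟨J1, J2⟩ := integral_zolotarevA_rpow h0 h1 n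
  rw [intervalIntegrable_iff_integrableOn_Ioo_of_le hpi.le] at J1
  rw [intervalIntegral.integral_of_le hpi.le, integral_Ioc_eq_integral_Ioo] at J2
  rw [setLIntegral_congr_fun measurableSet_Ioo e2,
    ← ofReal_integral_eq_lintegral_ofReal (J1.const_mul _), integral_const_mul, J2]
  · congr 1
    rw [show 1 + (n : ℝ) - α * n = n * (1 - α) + 1 by ring, add_comm 1 (α * (n : ℝ))]
    field_simp
  · filter_upwards [ae_restrict_mem measurableSet_Ioo] with φ hφ
    have := zolotarevA_pos h0 h1 hφ.1 hφ.2
    simp only [Pi.zero_apply]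
    positivity

lemma measurable_hDensity (α : ℝ) : Measurable (hDensity α) := by
  have hA := measurable_zolotarevA α
  have : StronglyMeasurable fun θ : ℝ => ∫ φ in Ioc (0 : ℝ) Real.pi,
      zolotarevA α φ * Real.exp (-(zolotarevA α φ * θ ^ (1 / (1 - α)))) := by
    refine StronglyMeasurable.integral_prod_right
      (f := fun (θ : ℝ) (φ : ℝ) => zolotarevA α φ * Real.exp (-(zolotarevA α φ * θ ^ (1 / (1 - α)))))
      (Measurable.stronglyMeasurable ?_)
    simp only [Function.uncurry_def]
    fun_prop
  unfold hDensity
  simp only [intervalIntegral.integral_of_le Real.pi_pos.le]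
  have := this.measurable
  fun_prop

/-- `h_α` has total mass `1`. -/
theorem lintegral_hDensity {α : ℝ} (h0 : 0 < α) (h1 : α < 1) :
    ∫⁻ θ in Ioi (0 : ℝ), ENNReal.ofReal (hDensity α θ) = 1 := by
  simpa using lintegral_pow_mul_hDensity h0 h1 0

/-- `∫_0^∞ e^{zθ} h_α(θ) dθ = E_{α,1}(z) = ∑_k z^k / Γ(αk+1)`, here for `z ≥ 0`. -/
theorem lintegral_exp_mul_hDensity {α : ℝ} (h0 : 0 < α) (h1 : α < 1) {z : ℝ} (hz : 0 ≤ z) :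
    ∫⁻ θ in Ioi (0 : ℝ), ENNReal.ofReal (Real.exp (z * θ) * hDensity α θ) =
      ∑' k : ℕ, ENNReal.ofReal (z ^ k / Real.Gamma (α * k + 1)) := by
  have e : ∀ θ ∈ Ioi (0 : ℝ), ENNReal.ofReal (Real.exp (z * θ) * hDensity α θ) =
      ∑' k : ℕ, ENNReal.ofReal (z ^ k / k.factorial) * ENNReal.ofReal (θ ^ k * hDensity α θ) := by
    intro θ (hθ : 0 < θ)
    have hh := hDensity_pos h0 h1 hθ
    have hs : HasSum (fun k : ℕ => (z * θ) ^ k / k.factorial) (Real.exp (z * θ)) := by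
      rw [Real.exp_eq_exp_ℝ]; exact NormedSpace.expSeries_div_hasSum_exp (z * θ)
    have hs2 := hs.mul_right (hDensity α θ)
    rw [← hs2.tsum_eq, ENNReal.ofReal_tsum_of_nonneg (fun k => by positivity) hs2.summable]
    refine tsum_congr fun k => ?_
    rw [← ENNReal.ofReal_mul (by positivity)]
    congr 1
    rw [mul_pow]
    ring
  have hm := measurable_hDensity α
  rw [setLIntegral_congr_fun measurableSet_Ioi e, lintegral_tsum (fun k => by fun_prop)]
  refine tsum_congr fun k => ?_
  rw [lintegral_const_mul _ (by fun_prop), lintegral_pow_mul_hDensity h0 h1,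
    ← ENNReal.ofReal_mul (by positivity)]
  congr 1
  field_simp

end TimeFractional

namespace TimeFractional

variable {N : ℕ}

/-! The solution is the supremum of the Picard iterates, and everything rests on one a priori bound
that is stable under the iteration. Hölder on balls (`morreyBound_of_rpow`) lowers `r` to an
exponent in `(1, p)`, so let `1 < r < p`. Put `κ = 2r/(p-1)`, `b = (p-r)/(p-1)` and `R = T^(α/2)`.
The data satisfy `∫_B μ^r ≤ A σ^(N-κ)` on balls `B` of radius `σ ≤ R`, and the claim is that every
iterate satisfies `∫_B u(t)^p ≤ K t^(-αb) σ^(N-κ)` on the same balls.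

The linear term: the heat flow does not increase the largest ball mass of `f^r` and bounds its
supremum by `C A ρ^(-κ)` for `ρ ≤ min(√t, R)`. Interpolating gives a `p`-bound
(`lintegral_ball_heat_rpow_le`), and Minkowski's inequality in `θ` carries it over to the averages
against `h_α` (`morreyBound_subord`). The Duhamel term: `u(s)^p` obeys an `L^1` Morrey bound, so the
same smoothing with `1` in place of `r` costs `(t-s)^(-αr/p)` in `L^p`. Minkowski in `s` leaves a
Beta integral whose power of `t` is exactly `-αb/p` (`morreyBound_duhamel`), because the Morrey
scale is invariant under the scaling of the equation. The claim thus reduces to `C₁ A^(p/r) + C₂ K^p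
≤ K`, which is met by small `K` and then small `A`.

All constants are independent of `α`. The singular moments of `h_α` are bounded uniformly through
Zolotarev's representation (`exists_rpow_neg_mul_hDensity_le`), and the factor `α` of the Duhamel
term cancels the `1/α` of the Beta integral (`lintegral_beta_le`). A single constant therefore
serves every `α`, which settles the limsup. Monotone convergence (`iSup_picard_eq`) turns the
iterates into a solution, and the a priori bound makes it finite almost everywhere. -/

/-! ### Jensen and Minkowski inequalities for `[0,∞]`-valued integrals -/

/-- Weighted Jensen inequality. -/
lemma lintegral_rpow_le_weighted {A : Type*} [MeasurableSpace A] {m : Measure A} {p : ℝ}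
    (hp : 1 ≤ p) {f W : A → ℝ≥0∞} (hf : AEMeasurable f m) (hW : AEMeasurable W m)
    (h0 : ∀ᵐ a ∂m, W a ≠ 0) (h1 : ∀ᵐ a ∂m, W a ≠ ∞) :
    (∫⁻ a, f a ∂m) ^ p ≤ (∫⁻ a, W a ∂m) ^ (p - 1) * ∫⁻ a, W a ^ (1 - p) * f a ^ p ∂m := by
  rcases hp.eq_or_lt with rfl | hp
  · simp
  have hpq : p.HolderConjugate (p / (p - 1)) := Real.HolderConjugate.conjExponent hp
  have hp0 : 0 < p := by linarith
  have hp1 : 0 < p - 1 := by linarith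
  -- Split off `W^((p-1)/p)` and apply Hölder with exponents `p` and `p/(p-1)`. Cancelling the two
  -- powers of `W` in `[0,∞]` is where `0 < W < ∞` is needed.
  have e : ∫⁻ a, f a ∂m = ∫⁻ a, (fun a => W a ^ ((1 - p) / p) * f a) a *
      (fun a => W a ^ ((p - 1) / p)) a ∂m := by
    refine lintegral_congr_ae ?_
    filter_upwards [h0, h1] with a h0 h1
    have : W a ^ ((1 - p) / p) * W a ^ ((p - 1) / p) = 1 := by
      rw [← ENNReal.rpow_add _ _ h0 h1, ← add_div]; simp
    rw [mul_right_comm, this, one_mul]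
  have H := ENNReal.lintegral_mul_le_Lp_mul_Lq m hpq
    (f := fun a => W a ^ ((1 - p) / p) * f a) (g := fun a => W a ^ ((p - 1) / p))
    ((hW.pow_const _).mul hf) (hW.pow_const _)
  simp only [Pi.mul_apply] at H
  rw [e]
  refine (ENNReal.rpow_le_rpow H hp0.le).trans_eq ?_
  rw [ENNReal.mul_rpow_of_nonneg _ _ hp0.le, ← ENNReal.rpow_mul, ← ENNReal.rpow_mul, mul_comm]
  congr 1
  · simp_rw [← ENNReal.rpow_mul]
    rw [show (p - 1) / p * (p / (p - 1)) = 1 by field_simp,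
      show 1 / (p / (p - 1)) * p = p - 1 by field_simp]
    simp
  · rw [one_div, inv_mul_cancel₀ hp0.ne', ENNReal.rpow_one]
    refine lintegral_congr fun a => ?_
    rw [ENNReal.mul_rpow_of_nonneg _ _ hp0.le, ← ENNReal.rpow_mul, div_mul_cancel₀ _ hp0.ne']

/-- A form of Minkowski's integral inequality. -/
lemma lintegral_lintegral_rpow_le {A X : Type*} [MeasurableSpace A] [MeasurableSpace X]
    {m : Measure A} {ν : Measure X} [SFinite m] [SFinite ν] {p : ℝ} (hp : 1 ≤ p)
    {f : A → X → ℝ≥0∞} {W : A → ℝ≥0∞} (hf : Measurable (Function.uncurry f)) (hW : Measurable W)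
    (h0 : ∀ᵐ a ∂m, W a ≠ 0) (h1 : ∀ᵐ a ∂m, W a ≠ ∞)
    (h : ∀ᵐ a ∂m, ∫⁻ x, f a x ^ p ∂ν ≤ W a ^ p) :
    ∫⁻ x, (∫⁻ a, f a x ∂m) ^ p ∂ν ≤ (∫⁻ a, W a ∂m) ^ p := by
  have hp0 : 0 < p := by linarith
  have hm : Measurable (Function.uncurry fun (x : X) (a : A) => W a ^ (1 - p) * f a x ^ p) := by
    have : Measurable fun z : X × A => f z.2 z.1 := hf.comp measurable_swap
    simp only [Function.uncurry_def]
    fun_prop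
  -- The weight in Jensen's inequality is the bound for the `L^p` norm itself, so that after Tonelli
  -- `W^(1-p) * W^p = W`.
  calc ∫⁻ x, (∫⁻ a, f a x ∂m) ^ p ∂ν
      ≤ ∫⁻ x, (∫⁻ a, W a ∂m) ^ (p - 1) * ∫⁻ a, W a ^ (1 - p) * f a x ^ p ∂m ∂ν :=
        lintegral_mono fun x => lintegral_rpow_le_weighted hp
          (hf.comp measurable_prodMk_right).aemeasurable hW.aemeasurable h0 h1
    _ = (∫⁻ a, W a ∂m) ^ (p - 1) * ∫⁻ a, W a ^ (1 - p) * ∫⁻ x, f a x ^ p ∂ν ∂m := by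
        rw [lintegral_const_mul _ (show Measurable fun x => ∫⁻ a, W a ^ (1 - p) * f a x ^ p ∂m from
            hm.lintegral_prod_right'),
          lintegral_lintegral_swap hm.aemeasurable]
        congr 1
        refine lintegral_congr fun a => ?_
        rw [lintegral_const_mul]
        exact (hf.comp measurable_prodMk_left).pow_const p
    _ ≤ (∫⁻ a, W a ∂m) ^ (p - 1) * ∫⁻ a, W a ∂m := by
        refine mul_le_mul_right (lintegral_mono_ae ?_) _
        filter_upwards [h0, h1, h] with a h0 h1 h
        calc _ ≤ W a ^ (1 - p) * W a ^ p := by gcongr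
          _ = W a := by rw [← ENNReal.rpow_add _ _ h0 h1]; simp
    _ = (∫⁻ a, W a ∂m) ^ p := by
        conv_lhs => enter [2]; rw [← ENNReal.rpow_one (∫⁻ a, W a ∂m)]
        rw [← ENNReal.rpow_add_of_nonneg _ _ (by linarith) zero_le_one]
        simp

/-! ### Heat kernel and ball masses -/

lemma heatKernel_pos {t : ℝ} (ht : 0 < t) (x : EuclideanSpace ℝ (Fin N)) : 0 < heatKernel t x := by
  unfold heatKernel
  positivity

lemma lintegral_heatKernel {t : ℝ} (ht : 0 < t) :
    ∫⁻ x : EuclideanSpace ℝ (Fin N), ENNReal.ofReal (heatKernel t x) = 1 := by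
  have hb : (0 : ℝ) < 1 / (4 * t) := by positivity
  have I := GaussianFourier.integral_rexp_neg_mul_sq_norm (V := EuclideanSpace ℝ (Fin N)) hb
  have hI : Integrable fun v : EuclideanSpace ℝ (Fin N) => Real.exp (-(1 / (4 * t)) * ‖v‖ ^ 2) := by
    -- The Bochner integral of a non-integrable function is `0` by convention, so the positive value
    -- in `I` forces integrability.
    by_contra hc
    rw [integral_undef hc] at I
    have : 0 < (Real.pi / (1 / (4 * t))) ^ (Module.finrank ℝ (EuclideanSpace ℝ (Fin N)) / 2 : ℝ) := by
      positivity
    linarith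
  have e : (heatKernel t : EuclideanSpace ℝ (Fin N) → ℝ) = fun v =>
      1 / (4 * Real.pi * t) ^ ((N : ℝ) / 2) * Real.exp (-(1 / (4 * t)) * ‖v‖ ^ 2) := by
    funext v
    unfold heatKernel
    congr 2
    ring
  rw [← ofReal_integral_eq_lintegral_ofReal]
  · rw [e, integral_const_mul, I, finrank_euclideanSpace_fin,
      show Real.pi / (1 / (4 * t)) = 4 * Real.pi * t by field_simp, one_div,
      inv_mul_cancel₀ (by positivity), ENNReal.ofReal_one]
  · rw [e]; exact hI.const_mul _
  · exact Eventually.of_forall fun x => (heatKernel_pos ht x).le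

lemma lintegral_heatKernel_sub {t : ℝ} (ht : 0 < t) (x : EuclideanSpace ℝ (Fin N)) :
    ∫⁻ y : EuclideanSpace ℝ (Fin N), ENNReal.ofReal (heatKernel t (x - y)) = 1 := by
  rw [lintegral_sub_left_eq_self (fun y => ENNReal.ofReal (heatKernel t y)) x,
    lintegral_heatKernel ht]

/-- `[e^{tΔ} f](x)` for a nonnegative function `f`. -/
noncomputable def heat (t : ℝ) (f : EuclideanSpace ℝ (Fin N) → ℝ≥0∞)
    (x : EuclideanSpace ℝ (Fin N)) : ℝ≥0∞ :=
  ∫⁻ y, ENNReal.ofReal (heatKernel t (x - y)) * f y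

lemma measurable_heatKernel_sub (t : ℝ) (x : EuclideanSpace ℝ (Fin N)) :
    Measurable fun y : EuclideanSpace ℝ (Fin N) => ENNReal.ofReal (heatKernel t (x - y)) := by
  unfold heatKernel
  fun_prop

lemma heatSemigroup_withDensity (t : ℝ) {f : EuclideanSpace ℝ (Fin N) → ℝ≥0∞} (hf : Measurable f)
    (x : EuclideanSpace ℝ (Fin N)) : heatSemigroup t (volume.withDensity f) x = heat t f x := by
  unfold heatSemigroup heat
  rw [lintegral_withDensity_eq_lintegral_mul _ hf (measurable_heatKernel_sub t x)]
  simp only [Pi.mul_apply, mul_comm]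

lemma measurable_heat_kernel_mul {A : Type*} [MeasurableSpace A] {τ : A → ℝ}
    {g : A → EuclideanSpace ℝ (Fin N) → ℝ≥0∞} (hτ : Measurable τ)
    (hg : Measurable (Function.uncurry g)) :
    Measurable fun z : A × EuclideanSpace ℝ (Fin N) => heat (τ z.1) (g z.1) z.2 := by
  unfold heat
  refine Measurable.lintegral_prod_right' (f := fun z : (A × EuclideanSpace ℝ (Fin N)) ×
    EuclideanSpace ℝ (Fin N) => ENNReal.ofReal (heatKernel (τ z.1.1) (z.1.2 - z.2)) * g z.1.1 z.2) ?_
  have h1 : Measurable fun z : (A × EuclideanSpace ℝ (Fin N)) × EuclideanSpace ℝ (Fin N) =>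
      g z.1.1 z.2 :=
    hg.comp (g := Function.uncurry g) 
      (f := fun z : (A × EuclideanSpace ℝ (Fin N)) × EuclideanSpace ℝ (Fin N) => (z.1.1, z.2)) (by fun_prop)
  unfold heatKernel
  fun_prop

/-- Jensen's inequality for the heat semigroup. -/
lemma heat_rpow_le {t r : ℝ} (ht : 0 < t) (hr : 1 ≤ r) {f : EuclideanSpace ℝ (Fin N) → ℝ≥0∞}
    (hf : Measurable f) (x : EuclideanSpace ℝ (Fin N)) :
    heat t f x ^ r ≤ heat t (fun y => f y ^ r) x := by
  have hm := measurable_heatKernel_sub t x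
  have hG : ∀ y, ENNReal.ofReal (heatKernel t (x - y)) ≠ 0 := fun y => by
    simpa using heatKernel_pos ht _
  unfold heat
  refine (lintegral_rpow_le_weighted hr (hm.mul hf).aemeasurable hm.aemeasurable
    (Eventually.of_forall hG) (Eventually.of_forall fun y => ENNReal.ofReal_ne_top)).trans_eq ?_
  rw [lintegral_heatKernel_sub ht, ENNReal.one_rpow, one_mul]
  refine lintegral_congr fun y => ?_
  simp only [Pi.mul_apply]
  rw [ENNReal.mul_rpow_of_nonneg _ _ (by linarith), ← mul_assoc,
    ← ENNReal.rpow_add _ _ (hG y) ENNReal.ofReal_ne_top]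
  simp

/-- The heat semigroup does not increase the largest mass of a ball. -/
lemma lintegral_ball_heat_le {t σ : ℝ} (ht : 0 < t) {f : EuclideanSpace ℝ (Fin N) → ℝ≥0∞}
    (hf : Measurable f) {M : ℝ≥0∞}
    (hM : ∀ z : EuclideanSpace ℝ (Fin N), ∫⁻ y in Metric.ball z σ, f y ≤ M)
    (z : EuclideanSpace ℝ (Fin N)) :
    ∫⁻ x in Metric.ball z σ, heat t f x ≤ M := by
  -- Written as a convolution, the heat flow is an average of translates of `f`, and a translate
  -- only moves the centre of the ball.
  have e : ∀ x, heat t f x = ∫⁻ w, ENNReal.ofReal (heatKernel t w) * f (x - w) := fun x => by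
    rw [← lintegral_sub_left_eq_self _ x]
    simp [heat]
  have hk : Measurable fun w : EuclideanSpace ℝ (Fin N) => ENNReal.ofReal (heatKernel t w) := by
    unfold heatKernel; fun_prop
  simp only [e]
  rw [lintegral_lintegral_swap]
  swap
  · have : Measurable fun q : EuclideanSpace ℝ (Fin N) × EuclideanSpace ℝ (Fin N) =>
      f (q.1 - q.2) := hf.comp (by fun_prop)
    have h2 : Measurable fun q : EuclideanSpace ℝ (Fin N) × EuclideanSpace ℝ (Fin N) =>
      ENNReal.ofReal (heatKernel t q.2) := hk.comp measurable_snd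
    exact (h2.mul this).aemeasurable
  calc _ ≤ ∫⁻ w : EuclideanSpace ℝ (Fin N), ENNReal.ofReal (heatKernel t w) * M := by
        refine lintegral_mono fun w => ?_
        rw [lintegral_const_mul _ (show Measurable fun x => f (x - w) from hf.comp (by fun_prop))]
        gcongr
        refine le_trans (le_of_eq ?_) (hM (z - w))
        rw [← lintegral_indicator Metric.isOpen_ball.measurableSet,
          ← lintegral_indicator Metric.isOpen_ball.measurableSet,
          ← lintegral_sub_right_eq_self (fun x => indicator (Metric.ball (z - w) σ) f x) w]
        refine lintegral_congr fun x => ?_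
        simp only [indicator, Metric.mem_ball, dist_sub_right]
    _ = M := by rw [lintegral_mul_const _ hk, lintegral_heatKernel ht, one_mul]

/-- Moving the source point by less than `√t` is absorbed by doubling the time: `|x-w|² ≤ 2|x-y|² +
2t` compares the exponents up to `1/4`, and the normalisations differ by `2^(N/2)`. -/
lemma heatKernel_le_of_dist_lt {t ρ : ℝ} (ht : 0 < t) (hρt : ρ ^ 2 ≤ t)
    {x y w : EuclideanSpace ℝ (Fin N)} (h : dist y w < ρ) :
    heatKernel t (x - y) ≤ 2 ^ ((N : ℝ) / 2) * Real.exp (1 / 4) * heatKernel (2 * t) (x - w) := by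
  have h1 : ‖x - w‖ ^ 2 ≤ 2 * ‖x - y‖ ^ 2 + 2 * t := by
    have h2 : ‖x - w‖ ≤ ‖x - y‖ + ρ := by
      have : x - w = (x - y) + (y - w) := by abel
      rw [this]
      refine (norm_add_le _ _).trans ?_
      rw [dist_eq_norm] at h
      gcongr
    calc ‖x - w‖ ^ 2 ≤ (‖x - y‖ + ρ) ^ 2 := by gcongr
      _ ≤ _ := by nlinarith [sq_nonneg (‖x - y‖ - ρ)]
  unfold heatKernel
  have hpt : 0 < 4 * Real.pi * t := by positivity
  rw [show 4 * Real.pi * (2 * t) = 2 * (4 * Real.pi * t) by ring,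
    Real.mul_rpow (x := 2) (by norm_num) hpt.le]
  have h3 : Real.exp (-(‖x - y‖ ^ 2 / (4 * t))) ≤
      Real.exp (1 / 4) * Real.exp (-(‖x - w‖ ^ 2 / (4 * (2 * t)))) := by
    rw [← Real.exp_add, Real.exp_le_exp]
    have : ‖x - w‖ ^ 2 / (4 * (2 * t)) ≤ (2 * ‖x - y‖ ^ 2 + 2 * t) / (4 * (2 * t)) := by gcongr
    have e : (2 * ‖x - y‖ ^ 2 + 2 * t) / (4 * (2 * t)) = ‖x - y‖ ^ 2 / (4 * t) + 1 / 4 := by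
      field_simp
    linarith
  have e2 : (2 : ℝ) ^ ((N : ℝ) / 2) * Real.exp (1 / 4) *
      (1 / (2 ^ ((N : ℝ) / 2) * (4 * Real.pi * t) ^ ((N : ℝ) / 2)) *
        Real.exp (-(‖x - w‖ ^ 2 / (4 * (2 * t))))) =
      1 / (4 * Real.pi * t) ^ ((N : ℝ) / 2) *
        (Real.exp (1 / 4) * Real.exp (-(‖x - w‖ ^ 2 / (4 * (2 * t))))) := by
    field_simp
  rw [e2]
  gcongr

/-- The heat semigroup maps functions with bounded ball masses to bounded functions. -/
lemma volume_ball_mul_heat_le {t ρ : ℝ} (ht : 0 < t) (hρt : ρ ^ 2 ≤ t)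
    {f : EuclideanSpace ℝ (Fin N) → ℝ≥0∞} (hf : Measurable f) {M : ℝ≥0∞}
    (hM : ∀ z : EuclideanSpace ℝ (Fin N), ∫⁻ y in Metric.ball z ρ, f y ≤ M)
    (x : EuclideanSpace ℝ (Fin N)) :
    volume (Metric.ball (0 : EuclideanSpace ℝ (Fin N)) ρ) * heat t f x ≤
      ENNReal.ofReal (2 ^ ((N : ℝ) / 2) * Real.exp (1 / 4)) * M := by
  set c := ENNReal.ofReal (2 ^ ((N : ℝ) / 2) * Real.exp (1 / 4)) with hc
  have hmk := measurable_heatKernel_sub (2 * t) x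
  -- The volume is spent on an extra integration over `w ∈ B(y,ρ)`. Replacing `y` by `w` in the
  -- kernel and exchanging the integrals leaves the mass of `f` on `B(w,ρ)`, integrated against a
  -- kernel of mass one.
  calc volume (Metric.ball (0 : EuclideanSpace ℝ (Fin N)) ρ) * heat t f x
      = ∫⁻ y, ∫⁻ w in Metric.ball y ρ, ENNReal.ofReal (heatKernel t (x - y)) * f y := by
        unfold heat
        rw [← lintegral_const_mul _ (show Measurable fun y => ENNReal.ofReal (heatKernel t (x - y)) * f y
          from (measurable_heatKernel_sub t x).mul hf)]
        refine lintegral_congr fun y => ?_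
        rw [setLIntegral_const, Measure.addHaar_ball_center volume y, mul_comm]
    _ ≤ ∫⁻ y, ∫⁻ w in Metric.ball y ρ, c * ENNReal.ofReal (heatKernel (2 * t) (x - w)) * f y := by
        refine lintegral_mono fun y => setLIntegral_mono' Metric.isOpen_ball.measurableSet
          fun w hw => ?_
        rw [hc, ← ENNReal.ofReal_mul (by positivity)]
        gcongr
        exact heatKernel_le_of_dist_lt ht hρt (by rwa [dist_comm])
    _ = ∫⁻ y, ∫⁻ w, (Metric.ball (0 : EuclideanSpace ℝ (Fin N)) ρ).indicator 1 (w - y) *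
          (c * ENNReal.ofReal (heatKernel (2 * t) (x - w)) * f y) := by
        refine lintegral_congr fun y => ?_
        rw [← lintegral_indicator Metric.isOpen_ball.measurableSet]
        refine lintegral_congr fun w => ?_
        simp only [indicator, Metric.mem_ball, dist_eq_norm, sub_zero, Pi.one_apply]
        split_ifs <;> simp
    _ = ∫⁻ w, ∫⁻ y, (Metric.ball (0 : EuclideanSpace ℝ (Fin N)) ρ).indicator 1 (w - y) *
          (c * ENNReal.ofReal (heatKernel (2 * t) (x - w)) * f y) := by
        rw [lintegral_lintegral_swap]
        have h1 : Measurable fun q : EuclideanSpace ℝ (Fin N) × EuclideanSpace ℝ (Fin N) =>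
            (Metric.ball (0 : EuclideanSpace ℝ (Fin N)) ρ).indicator (1 : EuclideanSpace ℝ (Fin N) → ℝ≥0∞) (q.2 - q.1) :=
          (measurable_one.indicator Metric.isOpen_ball.measurableSet).comp (by fun_prop)
        have h2 : Measurable fun q : EuclideanSpace ℝ (Fin N) × EuclideanSpace ℝ (Fin N) =>
            ENNReal.ofReal (heatKernel (2 * t) (x - q.2)) := hmk.comp measurable_snd
        exact (h1.mul ((h2.const_mul c).mul (hf.comp measurable_fst))).aemeasurable
    _ = ∫⁻ w, c * ENNReal.ofReal (heatKernel (2 * t) (x - w)) * ∫⁻ y in Metric.ball w ρ, f y := by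
        refine lintegral_congr fun w => ?_
        rw [← lintegral_indicator Metric.isOpen_ball.measurableSet,
          ← lintegral_const_mul _ (hf.indicator Metric.isOpen_ball.measurableSet)]
        refine lintegral_congr fun y => ?_
        simp only [indicator, Metric.mem_ball, dist_eq_norm, sub_zero, Pi.one_apply,
          norm_sub_rev w y]
        split_ifs <;> simp
    _ ≤ ∫⁻ w, c * ENNReal.ofReal (heatKernel (2 * t) (x - w)) * M := by
        refine lintegral_mono fun w => ?_
        gcongr
        exact hM w
    _ = c * M := by
        rw [lintegral_mul_const _ (hmk.const_mul c), lintegral_const_mul _ hmk,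
          lintegral_heatKernel_sub (by positivity), mul_one]

/-! ### Moments of `h_α`, uniformly in `α` -/

lemma exists_Gamma_bounds {a b : ℝ} (ha : 0 < a) :
    ∃ c C : ℝ, 0 < c ∧ 0 < C ∧ ∀ x ∈ Icc a b, c ≤ Real.Gamma x ∧ Real.Gamma x ≤ C := by
  rcases lt_or_ge b a with hab | hab
  · exact ⟨1, 1, one_pos, one_pos, fun x hx => by have := hx.1.trans hx.2; linarith⟩
  have hc : ContinuousOn Real.Gamma (Icc a b) := fun x hx =>
    (Real.differentiableAt_Gamma fun m => by
      have := ha.trans_le hx.1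
      have : (0 : ℝ) ≤ m := by positivity
      linarith).continuousAt.continuousWithinAt
  obtain ⟨x, hx, hmin⟩ := isCompact_Icc.exists_isMinOn (nonempty_Icc.2 hab) hc
  obtain ⟨y, hy, hmax⟩ := isCompact_Icc.exists_isMaxOn (nonempty_Icc.2 hab) hc
  exact ⟨_, _, Real.Gamma_pos_of_pos (ha.trans_le hx.1), Real.Gamma_pos_of_pos (ha.trans_le hy.1),
    fun z hz => ⟨hmin hz, hmax hz⟩⟩

/-- The integral representation of the negative moments of `h_α`. -/
lemma lintegral_rpow_neg_mul_hDensity {α b : ℝ} (h0 : 0 < α) (h1 : α < 1) (hb0 : 0 ≤ b)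
    (hb1 : b < 1) :
    ∫⁻ θ in Ioi (0 : ℝ), ENNReal.ofReal (θ ^ (-b) * hDensity α θ) =
      ∫⁻ φ in Ioo 0 Real.pi, ENNReal.ofReal (1 / Real.pi * Real.Gamma (1 - b * (1 - α)) *
        (zolotarevA α φ ^ (-(1 - α))) ^ (-b)) := by
  have ha : 0 < 1 - α := by linarith
  have hA := measurable_zolotarevA α
  have hpi := Real.pi_pos
  have hG : 0 < Real.Gamma (1 - b * (1 - α)) := Real.Gamma_pos_of_pos (by nlinarith)
  let f : ℝ → ℝ → ℝ := fun θ φ => 1 / (Real.pi * (1 - α)) * zolotarevA α φ *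
    (θ ^ (-b + α / (1 - α)) * Real.exp (-zolotarevA α φ * θ ^ (1 / (1 - α))))
  have e1 : ∀ θ ∈ Ioi (0 : ℝ), ENNReal.ofReal (θ ^ (-b) * hDensity α θ) =
      ∫⁻ φ in Ioo 0 Real.pi, ENNReal.ofReal (f θ φ) := by
    intro θ (hθ : 0 < θ)
    have e : θ ^ (-b) * hDensity α θ = ∫ φ in Ioo 0 Real.pi, f θ φ := by
      unfold hDensity
      rw [intervalIntegral.integral_of_le hpi.le, integral_Ioc_eq_integral_Ioo, ← mul_assoc,
        ← integral_const_mul]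
      refine integral_congr_ae (Eventually.of_forall fun φ => ?_)
      simp only [f, Real.rpow_add hθ]
      rw [neg_mul]
      ring
    rw [e, ofReal_integral_eq_lintegral_ofReal]
    · have := ((intervalIntegrable_iff_integrableOn_Ioo_of_le hpi.le).1
        (hDensity_integrable h0 h1 hθ)).const_mul
          (1 / (Real.pi * (1 - α)) * θ ^ (-b + α / (1 - α)))
      refine this.congr (Eventually.of_forall fun φ => ?_)
      simp only [f]
      rw [neg_mul]
      ring
    · filter_upwards [ae_restrict_mem measurableSet_Ioo] with φ hφ
      have := zolotarevA_pos h0 h1 hφ.1 hφ.2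
      simp only [f, Pi.zero_apply]
      positivity
  rw [setLIntegral_congr_fun measurableSet_Ioi e1, lintegral_lintegral_swap]
  swap
  · refine Measurable.aemeasurable ?_
    simp only [f, Function.uncurry_def]
    fun_prop
  refine setLIntegral_congr_fun measurableSet_Ioo fun φ hφ => ?_
  have hA0 := zolotarevA_pos h0 h1 hφ.1 hφ.2
  have hp : 0 < 1 / (1 - α) := by positivity
  have hq : (-1 : ℝ) < -b + α / (1 - α) := by
    have : (0 : ℝ) ≤ α / (1 - α) := by positivity
    linarith
  -- For fixed `φ` the `θ`-integral is a Gamma integral; `b < 1` keeps the exponent above `-1`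
  -- whatever `α` is.
  have I := integral_rpow_mul_exp_neg_mul_rpow hp hq hA0
  have q1 : (-b + α / (1 - α) + 1) / (1 / (1 - α)) = 1 - b * (1 - α) := by field_simp; ring
  have hi : IntegrableOn (fun θ : ℝ => θ ^ (-b + α / (1 - α)) *
      Real.exp (-zolotarevA α φ * θ ^ (1 / (1 - α)))) (Ioi 0) := by
    by_contra hcon
    rw [integral_undef hcon, q1] at I
    have : 0 < zolotarevA α φ ^ (-(-b + α / (1 - α) + 1) / (1 / (1 - α))) := by positivity
    have : 0 < zolotarevA α φ ^ (-(-b + α / (1 - α) + 1) / (1 / (1 - α))) *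
      (1 / (1 / (1 - α))) * Real.Gamma (1 - b * (1 - α)) := by positivity
    linarith
  simp only [f]
  rw [← ofReal_integral_eq_lintegral_ofReal (hi.const_mul _), integral_const_mul, I, neg_div, q1]
  · congr 1
    rw [← Real.rpow_mul hA0.le,
      show -(1 - b * (1 - α)) = -(1 - α) * -b - 1 by ring, Real.rpow_sub_one hA0.ne']
    field_simp
  · filter_upwards [ae_restrict_mem measurableSet_Ioi] with θ (hθ : 0 < θ)
    simp only [Pi.zero_apply]
    positivity

/-- The right side is the geometric mean, with weights `α` and `1-α`, of `sin φ / sin (αφ)` and `sin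
φ / sin ((1-α)φ)`, and both quotients are at least `sin φ`. The point is that the lower bound does
not involve `α`. -/
lemma zolotarevA_rpow_ge {α φ : ℝ} (h0 : 0 < α) (h1 : α < 1) (hφ : 0 < φ) (hφ' : φ < Real.pi) :
    Real.sin φ ≤ zolotarevA α φ ^ (-(1 - α)) := by
  have s1 := sin_pos_aux h0 h1 hφ hφ'
  have s2 := sin_pos_aux (c := 1 - α) (by linarith) (by linarith) hφ hφ'
  have s3 := Real.sin_pos_of_pos_of_lt_pi hφ hφ'
  have e : zolotarevA α φ ^ (-(1 - α)) =
      (Real.sin φ / Real.sin (α * φ)) ^ α * (Real.sin φ / Real.sin ((1 - α) * φ)) ^ (1 - α) := by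
    rw [zolotarevA_rpow h0 h1 hφ hφ', Real.div_rpow s1.le s2.le, Real.div_rpow s3.le s1.le,
      Real.div_rpow s3.le s2.le, Real.rpow_neg s1.le, Real.rpow_neg s2.le, Real.rpow_sub s2,
      Real.rpow_sub s3, Real.rpow_one, Real.rpow_one]
    field_simp
  have m : ∀ x : ℝ, 0 < Real.sin x → Real.sin φ ≤ Real.sin φ / Real.sin x := fun x hx => by
    rw [le_div_iff₀ hx]
    nlinarith [Real.sin_le_one x]
  rw [e]
  calc Real.sin φ = Real.sin φ ^ α * Real.sin φ ^ (1 - α) := by rw [← Real.rpow_add s3]; simp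
    _ ≤ _ := by
      have := m _ s1
      have := m _ s2
      have : 0 ≤ 1 - α := by linarith
      gcongr

/-- Jordan's inequality `sin φ ≥ 2φ/π` on the left half, and its reflection on the right half,
reduce this to integrable powers at the two endpoints. -/
lemma lintegral_sin_rpow_neg_lt_top {b : ℝ} (hb0 : 0 ≤ b) (hb1 : b < 1) :
    ∫⁻ φ in Ioo 0 Real.pi, ENNReal.ofReal (Real.sin φ ^ (-b)) < ∞ := by
  have hpi := Real.pi_pos
  have i1 : IntegrableOn (fun φ : ℝ => φ ^ (-b)) (Ioo 0 Real.pi) :=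
    (intervalIntegrable_iff_integrableOn_Ioo_of_le hpi.le).1
      (intervalIntegral.intervalIntegrable_rpow' (by linarith))
  have i2 : IntegrableOn (fun φ : ℝ => (Real.pi - φ) ^ (-b)) (Ioo 0 Real.pi) := by
    have : IntervalIntegrable (fun φ : ℝ => φ ^ (-b)) volume 0 Real.pi :=
      intervalIntegral.intervalIntegrable_rpow' (by linarith)
    have := (this.comp_sub_left Real.pi).symm
    simp only [sub_zero, sub_self] at this
    exact (intervalIntegrable_iff_integrableOn_Ioo_of_le hpi.le).1 this
  have i3 := ((i1.add i2).const_mul ((2 / Real.pi) ^ (-b)))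
  refine lt_of_le_of_lt ?_ i3.lintegral_lt_top
  refine setLIntegral_mono' measurableSet_Ioo fun φ hφ => ENNReal.ofReal_le_ofReal ?_
  have hs := Real.sin_pos_of_pos_of_lt_pi hφ.1 hφ.2
  have h3 : 0 < Real.pi - φ := by linarith [hφ.2]
  have h4 := hφ.1
  simp only [Pi.add_apply]
  rw [mul_add, ← Real.mul_rpow (by positivity) h4.le, ← Real.mul_rpow (by positivity) h3.le]
  rcases le_total φ (Real.pi / 2) with h | h
  · have := Real.mul_le_sin h4.le h
    have h5 : Real.sin φ ^ (-b) ≤ (2 / Real.pi * φ) ^ (-b) :=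
      Real.rpow_le_rpow_of_nonpos (by positivity) this (by linarith)
    have : 0 ≤ (2 / Real.pi * (Real.pi - φ)) ^ (-b) := by positivity
    linarith
  · have := Real.mul_le_sin h3.le (by linarith)
    rw [Real.sin_pi_sub] at this
    have h5 : Real.sin φ ^ (-b) ≤ (2 / Real.pi * (Real.pi - φ)) ^ (-b) :=
      Real.rpow_le_rpow_of_nonpos (by positivity) this (by linarith)
    have : 0 ≤ (2 / Real.pi * φ) ^ (-b) := by positivity
    linarith

/-- The negative moments of `h_α` are bounded uniformly in `α`. -/
lemma exists_rpow_neg_mul_hDensity_le {b : ℝ} (hb0 : 0 ≤ b) (hb1 : b < 1) :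
    ∃ C : ℝ, 0 < C ∧ ∀ α, 0 < α → α < 1 →
      ∫⁻ θ in Ioi (0 : ℝ), ENNReal.ofReal (θ ^ (-b) * hDensity α θ) ≤ ENNReal.ofReal C := by
  obtain ⟨c, C, hc, hC, h⟩ := exists_Gamma_bounds (a := 1 - b) (b := 1) (by linarith)
  have hpi := Real.pi_pos
  set D := ∫⁻ φ in Ioo 0 Real.pi, ENNReal.ofReal (Real.sin φ ^ (-b)) with hD
  have hDtop : D < ∞ := lintegral_sin_rpow_neg_lt_top hb0 hb1
  refine ⟨1 / Real.pi * C * D.toReal + 1, by positivity, fun α h0 h1 => ?_⟩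
  rw [lintegral_rpow_neg_mul_hDensity h0 h1 hb0 hb1]
  calc _ ≤ ∫⁻ φ in Ioo 0 Real.pi, ENNReal.ofReal (1 / Real.pi * C) *
        ENNReal.ofReal (Real.sin φ ^ (-b)) := by
        refine setLIntegral_mono' measurableSet_Ioo fun φ hφ => ?_
        have hs := Real.sin_pos_of_pos_of_lt_pi hφ.1 hφ.2
        rw [← ENNReal.ofReal_mul (by positivity)]
        refine ENNReal.ofReal_le_ofReal ?_
        have hG := h (1 - b * (1 - α)) ⟨by nlinarith, by nlinarith⟩
        have h5 := Real.rpow_le_rpow_of_nonpos hs (zolotarevA_rpow_ge h0 h1 hφ.1 hφ.2)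
          (neg_nonpos.2 hb0)
        have := hG.2
        have := hc.le.trans hG.1
        have := zolotarevA_pos h0 h1 hφ.1 hφ.2
        gcongr
    _ = ENNReal.ofReal (1 / Real.pi * C * D.toReal) := by
        rw [lintegral_const_mul' _ _ ENNReal.ofReal_ne_top,
          ENNReal.ofReal_mul (p := 1 / Real.pi * C) (by positivity),
          ENNReal.ofReal_toReal hDtop.ne]
    _ ≤ _ := ENNReal.ofReal_le_ofReal (by linarith)

lemma min_one_rpow_neg_le {θ b : ℝ} (hθ : 0 < θ) : (min θ 1) ^ (-b) ≤ 1 + θ ^ (-b) := by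
  have : 0 ≤ θ ^ (-b) := by positivity
  rcases le_total θ 1 with h | h
  · rw [min_eq_left h]; linarith
  · rw [min_eq_right h, Real.one_rpow]; linarith

/-- The truncation `min θ 1` reflects that the data are controlled only on balls of radius at most
`T^(α/2)`, so large `θ` brings no additional decay. -/
lemma exists_hDensity_mul_min_rpow_le {b : ℝ} (hb0 : 0 ≤ b) (hb1 : b < 1) :
    ∃ C : ℝ, 0 < C ∧ ∀ α, 0 < α → α < 1 →
      ∫⁻ θ in Ioi (0 : ℝ), ENNReal.ofReal (hDensity α θ * (min θ 1) ^ (-b)) ≤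
        ENNReal.ofReal C := by
  obtain ⟨C, hC, h⟩ := exists_rpow_neg_mul_hDensity_le hb0 hb1
  refine ⟨1 + C, by positivity, fun α h0 h1 => ?_⟩
  have hm := measurable_hDensity α
  calc _ ≤ ∫⁻ θ in Ioi (0 : ℝ), (ENNReal.ofReal (hDensity α θ) +
        ENNReal.ofReal (θ ^ (-b) * hDensity α θ)) := by
        refine setLIntegral_mono' measurableSet_Ioi fun θ hθ => ?_
        have hθ : 0 < θ := hθ
        have hd := hDensity_pos h0 h1 hθ
        rw [← ENNReal.ofReal_add hd.le (by positivity)]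
        refine ENNReal.ofReal_le_ofReal ?_
        nlinarith [min_one_rpow_neg_le (b := b) hθ]
    _ ≤ _ := by
        rw [lintegral_add_left (by fun_prop), lintegral_hDensity h0 h1,
          ENNReal.ofReal_add zero_le_one hC.le, ENNReal.ofReal_one]
        gcongr
        exact h α h0 h1

/-- The factor `θ` absorbs the singularity, since `θ^(1-b) ≤ 1` for `θ ≤ 1`. Only the mass and the
first moment `1/Γ(α+1)` are needed, and `Γ` is bounded below on `[1,2]`. -/
lemma exists_mul_hDensity_mul_min_rpow_le {b : ℝ} (hb1 : b < 1) :
    ∃ C : ℝ, 0 < C ∧ ∀ α, 0 < α → α < 1 →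
      ∫⁻ θ in Ioi (0 : ℝ), ENNReal.ofReal (θ * hDensity α θ * (min θ 1) ^ (-b)) ≤
        ENNReal.ofReal C := by
  obtain ⟨c, _, hc, _, h⟩ := exists_Gamma_bounds (a := 1) (b := 2) one_pos
  refine ⟨1 + 1 / c, by positivity, fun α h0 h1 => ?_⟩
  have hm := measurable_hDensity α
  have hmom := lintegral_pow_mul_hDensity h0 h1 1
  simp only [pow_one, Nat.factorial_one, Nat.cast_one, mul_one] at hmom
  calc _ ≤ ∫⁻ θ in Ioi (0 : ℝ), (ENNReal.ofReal (hDensity α θ) +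
        ENNReal.ofReal (θ * hDensity α θ)) := by
        refine setLIntegral_mono' measurableSet_Ioi fun θ hθ => ?_
        have hθ : 0 < θ := hθ
        have hd := hDensity_pos h0 h1 hθ
        rw [← ENNReal.ofReal_add hd.le (by positivity)]
        refine ENNReal.ofReal_le_ofReal ?_
        have : θ * min θ 1 ^ (-b) ≤ 1 + θ := by
          rcases le_total θ 1 with h | h
          · rw [min_eq_left h]
            have h2 : θ * θ ^ (-b) = θ ^ (1 - b) := by
              rw [sub_eq_add_neg, Real.rpow_add hθ, Real.rpow_one]
            have := Real.rpow_le_one hθ.le h (show 0 ≤ 1 - b by linarith)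
            linarith
          · rw [min_eq_right h, Real.one_rpow]; linarith
        nlinarith
    _ ≤ _ := by
        rw [lintegral_add_left (by fun_prop), lintegral_hDensity h0 h1,
          ENNReal.ofReal_add zero_le_one (by positivity), ENNReal.ofReal_one, hmom]
        gcongr
        exact (h _ ⟨by linarith, by linarith⟩).1

/-! ### Morrey bounds and heat smoothing -/

/-- The balls of radius `σ ≤ R` have mass at most `A σ^{N-κ}` with respect to `f dx`. -/
def MorreyBound (f : EuclideanSpace ℝ (Fin N) → ℝ≥0∞) (R κ A : ℝ) : Prop :=
  ∀ (z : EuclideanSpace ℝ (Fin N)) (σ : ℝ), 0 < σ → σ ≤ R →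
    ∫⁻ y in Metric.ball z σ, f y ≤ ENNReal.ofReal (A * σ ^ ((N : ℝ) - κ))

/-- The constant in the smoothing estimate `heat_le_of_morreyBound`. -/
noncomputable def heatConst (N : ℕ) : ℝ :=
  2 ^ ((N : ℝ) / 2) * Real.exp (1 / 4) /
    (volume (Metric.ball (0 : EuclideanSpace ℝ (Fin N)) 1)).toReal

lemma toReal_volume_ball_pos :
    0 < (volume (Metric.ball (0 : EuclideanSpace ℝ (Fin N)) 1)).toReal :=
  ENNReal.toReal_pos (Metric.measure_ball_pos _ _ one_pos).ne' measure_ball_lt_top.ne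

lemma heatConst_pos : 0 < heatConst N := by
  have := toReal_volume_ball_pos (N := N)
  unfold heatConst
  positivity

lemma volume_ball_eq_ofReal {ρ : ℝ} (hρ : 0 < ρ) (z : EuclideanSpace ℝ (Fin N)) :
    volume (Metric.ball z ρ) = ENNReal.ofReal
      (ρ ^ (N : ℝ) * (volume (Metric.ball (0 : EuclideanSpace ℝ (Fin N)) 1)).toReal) := by
  rw [Measure.addHaar_ball_of_pos _ _ hρ, finrank_euclideanSpace_fin, Real.rpow_natCast,
    ENNReal.ofReal_mul (by positivity), ENNReal.ofReal_toReal measure_ball_lt_top.ne]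

lemma heat_le_of_morreyBound {t ρ R κ A : ℝ} (ht : 0 < t) (hρ : 0 < ρ) (hρt : ρ ^ 2 ≤ t)
    (hρR : ρ ≤ R) {f : EuclideanSpace ℝ (Fin N) → ℝ≥0∞} (hf : Measurable f)
    (h : MorreyBound f R κ A) (x : EuclideanSpace ℝ (Fin N)) :
    heat t f x ≤ ENNReal.ofReal (heatConst N * A * ρ ^ (-κ)) := by
  have hv := toReal_volume_ball_pos (N := N)
  have H := volume_ball_mul_heat_le ht hρt hf (fun z => h z ρ hρ hρR) x
  rw [volume_ball_eq_ofReal hρ, ← ENNReal.ofReal_mul (by positivity)] at H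
  have hpos : 0 < ρ ^ (N : ℝ) * (volume (Metric.ball (0 : EuclideanSpace ℝ (Fin N)) 1)).toReal := by
    positivity
  rw [mul_comm, ← ENNReal.le_div_iff_mul_le (Or.inl (by simpa using hpos))
    (Or.inl ENNReal.ofReal_ne_top), ← ENNReal.ofReal_div_of_pos hpos] at H
  refine H.trans_eq ?_
  congr 1
  unfold heatConst
  rw [sub_eq_add_neg, Real.rpow_add hρ]
  field_simp

/-- With `H = e^{tΔ}(f^r)`, Jensen gives `(e^{tΔ}f)^p ≤ H^(p/r) = H^((p-r)/r) * H`. The first factor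
is bounded by smoothing at radius `ρ`, the second is integrated by conservation of ball masses, so
the power of `σ` is unchanged. -/
lemma lintegral_ball_heat_rpow_le {t ρ R κ A r p : ℝ} (ht : 0 < t) (hρ : 0 < ρ)
    (hρt : ρ ^ 2 ≤ t) (hρR : ρ ≤ R) (hr : 1 ≤ r) (hrp : r ≤ p)
    {f : EuclideanSpace ℝ (Fin N) → ℝ≥0∞} (hf : Measurable f) (hA : 0 < A)
    (h : MorreyBound (fun y => f y ^ r) R κ A) :
    MorreyBound (fun x => heat t f x ^ p) R κ
      (heatConst N ^ ((p - r) / r) * A ^ (p / r) * ρ ^ (-(κ * (p - r) / r))) := by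
  intro z σ hσ hσR
  have hr0 : 0 < r := by linarith
  have hc := heatConst_pos (N := N)
  have hfr : Measurable fun y => f y ^ r := hf.pow_const r
  have hq : 0 ≤ (p - r) / r := div_nonneg (by linarith) hr0.le
  have hsup := heat_le_of_morreyBound ht hρ hρt hρR hfr h
  have hball := lintegral_ball_heat_le ht hfr (fun z => h z σ hσ hσR) z
  have hmain : ∀ x, heat t f x ^ p ≤ ENNReal.ofReal ((heatConst N * A * ρ ^ (-κ)) ^ ((p - r) / r)) *
      heat t (fun y => f y ^ r) x := by
    intro x
    set H := heat t (fun y => f y ^ r) x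
    calc heat t f x ^ p = (heat t f x ^ r) ^ (p / r) := by
          rw [← ENNReal.rpow_mul, mul_div_cancel₀ _ hr0.ne']
      _ ≤ H ^ (p / r) :=
          ENNReal.rpow_le_rpow (heat_rpow_le ht hr hf x) (div_nonneg (by linarith) hr0.le)
      _ = H ^ ((p - r) / r) * H := by
          conv_rhs => enter [2]; rw [← ENNReal.rpow_one H]
          rw [← ENNReal.rpow_add_of_nonneg _ _ hq zero_le_one, sub_div, div_self hr0.ne',
            sub_add_cancel]
      _ ≤ _ := by
          rw [← ENNReal.ofReal_rpow_of_nonneg (by positivity) hq]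
          gcongr
          exact hsup x
  calc _ ≤ ∫⁻ x in Metric.ball z σ,
        ENNReal.ofReal ((heatConst N * A * ρ ^ (-κ)) ^ ((p - r) / r)) *
          heat t (fun y => f y ^ r) x := lintegral_mono hmain
    _ = ENNReal.ofReal ((heatConst N * A * ρ ^ (-κ)) ^ ((p - r) / r)) *
          ∫⁻ x in Metric.ball z σ, heat t (fun y => f y ^ r) x :=
        lintegral_const_mul' _ _ ENNReal.ofReal_ne_top
    _ ≤ ENNReal.ofReal ((heatConst N * A * ρ ^ (-κ)) ^ ((p - r) / r)) *
          ENNReal.ofReal (A * σ ^ ((N : ℝ) - κ)) := by gcongr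
    _ = _ := by
        rw [← ENNReal.ofReal_mul (by positivity)]
        congr 1
        rw [Real.mul_rpow (by positivity) (by positivity), Real.mul_rpow (by positivity) hA.le,
          ← Real.rpow_mul hρ.le, show p / r = (p - r) / r + 1 by field_simp; ring,
          Real.rpow_add_one hA.ne', show -κ * ((p - r) / r) = -(κ * (p - r) / r) by ring]
        ring

/-! ### Averages of the heat semigroup over `θ` -/

/-- The average `∫_0^∞ w(θ) e^{τθΔ} f dθ` of the heat semigroup. -/
noncomputable def subord (w : ℝ → ℝ) (τ : ℝ) (f : EuclideanSpace ℝ (Fin N) → ℝ≥0∞)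
    (x : EuclideanSpace ℝ (Fin N)) : ℝ≥0∞ :=
  ∫⁻ θ in Ioi (0 : ℝ), ENNReal.ofReal (w θ) * heat (τ * θ) f x

lemma opP_withDensity (α t : ℝ) {f : EuclideanSpace ℝ (Fin N) → ℝ≥0∞} (hf : Measurable f)
    (x : EuclideanSpace ℝ (Fin N)) :
    opP α t (volume.withDensity f) x = subord (hDensity α) (t ^ α) f x := by
  simp only [opP, subord, heatSemigroup_withDensity _ hf]

lemma opS_withDensity (α t : ℝ) {f : EuclideanSpace ℝ (Fin N) → ℝ≥0∞} (hf : Measurable f)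
    (x : EuclideanSpace ℝ (Fin N)) :
    opS α t (volume.withDensity f) x = subord (fun θ => θ * hDensity α θ) (t ^ α) f x := by
  simp only [opS, subord, heatSemigroup_withDensity _ hf]

lemma measurable_subord {A : Type*} [MeasurableSpace A] {w : ℝ → ℝ} (hw : Measurable w) {τ : A → ℝ}
    (hτ : Measurable τ) {g : A → EuclideanSpace ℝ (Fin N) → ℝ≥0∞}
    (hg : Measurable (Function.uncurry g)) :
    Measurable fun z : A × EuclideanSpace ℝ (Fin N) => subord w (τ z.1) (g z.1) z.2 := by
  unfold subord
  refine Measurable.lintegral_prod_right' (f := fun z : (A × EuclideanSpace ℝ (Fin N)) × ℝ =>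
    ENNReal.ofReal (w z.2) * heat (τ z.1.1 * z.2) (g z.1.1) z.1.2) ?_
  have h1 := measurable_heat_kernel_mul (A := A × ℝ) (τ := fun a => τ a.1 * a.2)
    (g := fun a => g a.1) (by fun_prop)
    (hg.comp (g := Function.uncurry g)
      (f := fun z : (A × ℝ) × EuclideanSpace ℝ (Fin N) => (z.1.1, z.2)) (by fun_prop))
  have h2 := h1.comp (f := fun z : (A × EuclideanSpace ℝ (Fin N)) × ℝ => ((z.1.1, z.2), z.1.2))
    (by fun_prop)
  have h3 : Measurable fun z : (A × EuclideanSpace ℝ (Fin N)) × ℝ => ENNReal.ofReal (w z.2) := by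
    fun_prop
  exact h3.mul h2

/-- Minkowski's inequality in `θ` applied to the heat estimate. It serves twice: for `P_α` acting on
the data, and with `r = 1` for `S_α` acting on the source. -/
lemma morreyBound_subord {τ R κ A r p d M : ℝ} (hτ : 0 < τ) (hR : 0 < R) (hτR : τ ≤ R ^ 2)
    (hr : 1 ≤ r) (hrp : r ≤ p) (hd : d = κ * (p - r) / (2 * r)) (hM : 0 < M) (hA : 0 < A)
    {w : ℝ → ℝ} (hw : Measurable w) (hw0 : ∀ θ, 0 < θ → 0 < w θ)
    (hwM : ∫⁻ θ in Ioi (0 : ℝ), ENNReal.ofReal (w θ * (min θ 1) ^ (-(d / p))) ≤ ENNReal.ofReal M)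
    {f : EuclideanSpace ℝ (Fin N) → ℝ≥0∞} (hf : Measurable f)
    (h : MorreyBound (fun y => f y ^ r) R κ A) :
    MorreyBound (fun x => subord w τ f x ^ p) R κ
      (heatConst N ^ ((p - r) / r) * A ^ (p / r) * τ ^ (-d) * M ^ p) := by
  intro z σ hσ hσR
  have hp1 : 1 ≤ p := hr.trans hrp
  have hp0 : 0 < p := by linarith
  have hc := heatConst_pos (N := N)
  -- `D^(1/p)` is the part of the `L^p(B(z,σ))` bound that does not depend on `θ`.
  set D := heatConst N ^ ((p - r) / r) * A ^ (p / r) * τ ^ (-d) * σ ^ ((N : ℝ) - κ) with hD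
  have hD0 : 0 < D := by positivity
  let W : ℝ → ℝ≥0∞ := fun θ => ENNReal.ofReal (w θ * (min θ 1) ^ (-(d / p)) * D ^ (1 / p))
  have hWm : Measurable W := by fun_prop
  have hmeas : Measurable (Function.uncurry fun (θ : ℝ) (x : EuclideanSpace ℝ (Fin N)) =>
      ENNReal.ofReal (w θ) * heat (τ * θ) f x) := by
    have h1 := measurable_heat_kernel_mul (A := ℝ) (τ := fun θ => τ * θ)
      (g := fun _ => f) (by fun_prop) (hf.comp measurable_snd)
    have h3 : Measurable fun z : ℝ × EuclideanSpace ℝ (Fin N) => ENNReal.ofReal (w z.1) := by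
      fun_prop
    exact h3.mul h1
  have H := lintegral_lintegral_rpow_le (m := volume.restrict (Ioi (0 : ℝ)))
    (ν := volume.restrict (Metric.ball z σ)) hp1 hmeas hWm ?_ ?_ ?_
  · refine H.trans ?_
    have hW : ∫⁻ θ in Ioi (0 : ℝ), W θ ≤ ENNReal.ofReal (M * D ^ (1 / p)) := by
      calc _ = (∫⁻ θ in Ioi (0 : ℝ), ENNReal.ofReal (w θ * (min θ 1) ^ (-(d / p)))) *
            ENNReal.ofReal (D ^ (1 / p)) := by
            rw [← lintegral_mul_const' _ _ ENNReal.ofReal_ne_top]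
            refine lintegral_congr fun θ => ?_
            rw [← ENNReal.ofReal_mul' (by positivity)]
        _ ≤ _ := by
            rw [ENNReal.ofReal_mul hM.le]
            gcongr
    calc _ ≤ ENNReal.ofReal (M * D ^ (1 / p)) ^ p := by gcongr
      _ = _ := by
        rw [ENNReal.ofReal_rpow_of_nonneg (by positivity) hp0.le]
        congr 1
        rw [Real.mul_rpow hM.le (by positivity), ← Real.rpow_mul hD0.le, one_div,
          inv_mul_cancel₀ hp0.ne', Real.rpow_one, hD]
        ring
  · filter_upwards [ae_restrict_mem measurableSet_Ioi] with θ (hθ : 0 < θ)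
    have := hw0 θ hθ
    have : 0 < min θ 1 := lt_min hθ one_pos
    have : 0 < w θ * (min θ 1) ^ (-(d / p)) * D ^ (1 / p) := by positivity
    simpa [W] using this
  · exact Eventually.of_forall fun θ => ENNReal.ofReal_ne_top
  · filter_upwards [ae_restrict_mem measurableSet_Ioi] with θ (hθ : 0 < θ)
    have hwθ := hw0 θ hθ
    have hm : 0 < min θ 1 := lt_min hθ one_pos
    have hτm : 0 < τ * min θ 1 := by positivity
    -- The natural radius `√(τθ)` is cut off at `√τ ≤ R`, beyond which the Morrey bound need not be
    -- available.
    have key := lintegral_ball_heat_rpow_le (t := τ * θ) (ρ := Real.sqrt (τ * min θ 1)) (by positivity)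
      (Real.sqrt_pos.2 hτm)
      (by rw [Real.sq_sqrt hτm.le]; gcongr; exact min_le_left _ _)
      (by
        rw [Real.sqrt_le_left hR.le]
        calc τ * min θ 1 ≤ τ * 1 := by gcongr; exact min_le_right _ _
          _ ≤ R ^ 2 := by linarith) hr hrp hf hA h z σ hσ hσR
    have e : Real.sqrt (τ * min θ 1) ^ (-(κ * (p - r) / r)) = τ ^ (-d) * (min θ 1) ^ (-d) := by
      rw [Real.sqrt_eq_rpow, ← Real.rpow_mul hτm.le, ← Real.mul_rpow hτ.le hm.le]
      congr 1
      rw [hd]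
      have : r ≠ 0 := by linarith
      field_simp
    rw [e] at key
    calc ∫⁻ x in Metric.ball z σ, (ENNReal.ofReal (w θ) * heat (τ * θ) f x) ^ p
        = ENNReal.ofReal (w θ ^ p) * ∫⁻ x in Metric.ball z σ, heat (τ * θ) f x ^ p := by
          rw [← lintegral_const_mul' _ _ ENNReal.ofReal_ne_top]
          refine lintegral_congr fun x => ?_
          rw [ENNReal.mul_rpow_of_nonneg _ _ hp0.le, ENNReal.ofReal_rpow_of_nonneg hwθ.le hp0.le]
      _ ≤ _ := by
          refine (mul_le_mul_right key _).trans_eq ?_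
          simp only [W]
          rw [← ENNReal.ofReal_mul (by positivity), ENNReal.ofReal_rpow_of_nonneg (by positivity) hp0.le]
          congr 1
          rw [Real.mul_rpow (by positivity) (by positivity), ← Real.rpow_mul hD0.le, one_div,
            inv_mul_cancel₀ hp0.ne', Real.rpow_one, Real.mul_rpow hwθ.le (by positivity),
            ← Real.rpow_mul hm.le, neg_mul, div_mul_cancel₀ _ hp0.ne', hD]
          ring

/-! ### The Beta integral and the Duhamel term -/

lemma lintegral_Ioo_rpow {q t : ℝ} (hq : -1 < q) (ht : 0 < t) :
    ∫⁻ s in Ioo 0 t, ENNReal.ofReal (s ^ q) = ENNReal.ofReal (t ^ (q + 1) / (q + 1)) := by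
  rw [← ofReal_integral_eq_lintegral_ofReal]
  · rw [← integral_Ioc_eq_integral_Ioo, ← intervalIntegral.integral_of_le ht.le,
      integral_rpow (Or.inl hq), Real.zero_rpow (by linarith), sub_zero]
  · exact (intervalIntegrable_iff_integrableOn_Ioo_of_le ht.le).1
      (intervalIntegral.intervalIntegrable_rpow' hq)
  · filter_upwards [ae_restrict_mem measurableSet_Ioo] with s hs
    exact Real.rpow_nonneg hs.1.le _

lemma lintegral_Ioo_sub_rpow {q t : ℝ} (hq : -1 < q) (ht : 0 < t) :
    ∫⁻ s in Ioo 0 t, ENNReal.ofReal ((t - s) ^ q) = ENNReal.ofReal (t ^ (q + 1) / (q + 1)) := by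
  rw [← lintegral_Ioo_rpow hq ht, ← lintegral_indicator measurableSet_Ioo,
    ← lintegral_indicator measurableSet_Ioo, ← lintegral_sub_left_eq_self _ t]
  refine lintegral_congr fun s => ?_
  simp only [indicator, mem_Ioo, sub_sub_cancel, sub_pos, sub_lt_self_iff, and_comm]

/-- Splitting at `t/2` leaves one singular factor on each half. The prefactor `α` cancels the
`1/(αc)` coming from `s = t`, and `1 - αb ≥ 1 - b` handles `s = 0`, so the constant is free of `α`.
-/
lemma lintegral_beta_le {α b c t : ℝ} (h0 : 0 < α) (h1 : α < 1) (hb0 : 0 ≤ b) (hb1 : b < 1)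
    (hc0 : 0 < c) (hc1 : c < 1) (ht : 0 < t) :
    ∫⁻ s in Ioo 0 t, ENNReal.ofReal (α * ((t - s) ^ (α * c - 1) * s ^ (-(α * b)))) ≤
      ENNReal.ofReal ((2 / (1 - b) + 2 / c) * t ^ (α * c - α * b)) := by
  have hαc : α * c < 1 := by nlinarith
  have hαb : α * b < 1 := by nlinarith
  have hαc0 : 0 < α * c := by positivity
  have hαb0 : 0 ≤ α * b := by positivity
  have hp : ∀ s ∈ Ioo 0 t, ENNReal.ofReal (α * ((t - s) ^ (α * c - 1) * s ^ (-(α * b)))) ≤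
      ENNReal.ofReal (α * (t / 2) ^ (α * c - 1)) * ENNReal.ofReal (s ^ (-(α * b))) +
      ENNReal.ofReal (α * (t / 2) ^ (-(α * b))) * ENNReal.ofReal ((t - s) ^ (α * c - 1)) := by
    intro s hs
    have hs0 := hs.1
    have hs1 : 0 < t - s := by linarith [hs.2]
    rw [← ENNReal.ofReal_mul (by positivity), ← ENNReal.ofReal_mul (by positivity),
      ← ENNReal.ofReal_add (by positivity) (by positivity)]
    refine ENNReal.ofReal_le_ofReal ?_
    have p1 : 0 < s ^ (-(α * b)) := by positivity
    have p2 : 0 < (t - s) ^ (α * c - 1) := by positivity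
    rcases le_total s (t / 2) with h | h
    · have q : (t - s) ^ (α * c - 1) ≤ (t / 2) ^ (α * c - 1) :=
        Real.rpow_le_rpow_of_nonpos (by positivity) (by linarith) (by linarith)
      have : 0 ≤ α * (t / 2) ^ (-(α * b)) * (t - s) ^ (α * c - 1) := by positivity
      have : α * ((t - s) ^ (α * c - 1) * s ^ (-(α * b))) ≤
        α * ((t / 2) ^ (α * c - 1) * s ^ (-(α * b))) := by gcongr
      linarith
    · have q : s ^ (-(α * b)) ≤ (t / 2) ^ (-(α * b)) :=
        Real.rpow_le_rpow_of_nonpos (by positivity) (by linarith) (by linarith)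
      have : 0 ≤ α * (t / 2) ^ (α * c - 1) * s ^ (-(α * b)) := by positivity
      have : α * ((t - s) ^ (α * c - 1) * s ^ (-(α * b))) ≤
        α * ((t - s) ^ (α * c - 1) * (t / 2) ^ (-(α * b))) := by gcongr
      linarith
  refine (setLIntegral_mono' measurableSet_Ioo hp).trans ?_
  have hd1 : 0 < 1 - α * b := by linarith
  rw [lintegral_add_left (by fun_prop), lintegral_const_mul' _ _ ENNReal.ofReal_ne_top,
    lintegral_const_mul' _ _ ENNReal.ofReal_ne_top, lintegral_Ioo_rpow (by linarith) ht,
    lintegral_Ioo_sub_rpow (by linarith) ht, ← ENNReal.ofReal_mul (by positivity),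
    ← ENNReal.ofReal_mul (by positivity), sub_add_cancel, show -(α * b) + 1 = 1 - α * b by ring,
    ← ENNReal.ofReal_add (by positivity) (by positivity)]
  refine ENNReal.ofReal_le_ofReal ?_
  have e1 : (t / 2) ^ (α * c - 1) * t ^ (1 - α * b) = 2 ^ (1 - α * c) * t ^ (α * c - α * b) := by
    rw [div_eq_mul_inv, Real.mul_rpow ht.le (by norm_num), Real.inv_rpow (by norm_num),
      ← Real.rpow_neg (by norm_num), neg_sub, mul_right_comm, ← Real.rpow_add ht, mul_comm]
    congr 2
    ring
  have e2 : (t / 2) ^ (-(α * b)) * t ^ (α * c) = 2 ^ (α * b) * t ^ (α * c - α * b) := by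
    rw [div_eq_mul_inv, Real.mul_rpow ht.le (by norm_num), Real.inv_rpow (by norm_num),
      ← Real.rpow_neg (by norm_num), neg_neg, mul_right_comm, ← Real.rpow_add ht, mul_comm]
    congr 2
    ring
  have f1 : (2 : ℝ) ^ (1 - α * c) ≤ 2 := by
    simpa using Real.rpow_le_rpow_of_exponent_le (x := 2) (by norm_num) (show 1 - α * c ≤ 1 by linarith)
  have f2 : (2 : ℝ) ^ (α * b) ≤ 2 := by
    simpa using Real.rpow_le_rpow_of_exponent_le (x := 2) (by norm_num) hαb.le
  set X := t ^ (α * c - α * b) with hX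
  have hX0 : 0 ≤ X := by positivity
  have g1 : α * (t / 2) ^ (α * c - 1) * (t ^ (1 - α * b) / (1 - α * b)) ≤ 2 / (1 - b) * X := by
    calc _ = α * 2 ^ (1 - α * c) / (1 - α * b) * X := by rw [← mul_div_assoc, mul_assoc, e1]; ring
      _ ≤ 1 * 2 / (1 - b) * X := by
        have : 0 < 1 - b := by linarith
        gcongr
        nlinarith
      _ = _ := by ring
  have g2 : α * (t / 2) ^ (-(α * b)) * (t ^ (α * c) / (α * c)) ≤ 2 / c * X := by
    calc _ = 2 ^ (α * b) / c * X := by rw [← mul_div_assoc, mul_assoc, e2]; field_simp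
      _ ≤ 2 / c * X := by gcongr
  rw [add_mul]
  linarith

/-- The Duhamel term `α ∫_0^t (t-s)^{α-1} S_α(t-s) v(s) ds`. -/
noncomputable def duhamel (α : ℝ) (v : ℝ → EuclideanSpace ℝ (Fin N) → ℝ≥0∞) (t : ℝ)
    (x : EuclideanSpace ℝ (Fin N)) : ℝ≥0∞ :=
  ENNReal.ofReal α * ∫⁻ s in Ioo 0 t, ENNReal.ofReal ((t - s) ^ (α - 1)) *
    subord (fun θ => θ * hDensity α θ) ((t - s) ^ α) (v s) x

/-- The inductive step of the a priori bound, with `v = u^p`: the power of `t` and the Morrey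
exponent are reproduced, while `K` becomes a multiple of `K^p`. Minkowski in `s` reduces it to the
Beta integral. -/
lemma morreyBound_duhamel {α t R κ K r p b M : ℝ} (h0 : 0 < α) (h1 : α < 1) (ht : 0 < t)
    (hR : 0 < R) (htR : t ^ α ≤ R ^ 2) (hr : 1 < r) (hrp : r < p) (hκ : κ * (p - 1) = 2 * r)
    (hb : b = (p - r) / (p - 1)) (hM : 0 < M) (hK : 0 < K)
    (hwM : ∫⁻ θ in Ioi (0 : ℝ), ENNReal.ofReal (θ * hDensity α θ * (min θ 1) ^ (-(r / p))) ≤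
      ENNReal.ofReal M)
    {v : ℝ → EuclideanSpace ℝ (Fin N) → ℝ≥0∞} (hv : Measurable (Function.uncurry v))
    (h : ∀ s ∈ Ioo 0 t, MorreyBound (v s) R κ (K * s ^ (-(α * b)))) :
    MorreyBound (fun x => duhamel α v t x ^ p) R κ
      (heatConst N ^ (p - 1) * M ^ p * (2 / (1 - b) + 2 / (1 - r / p)) ^ p * K ^ p *
        t ^ (-(α * b))) := by
  intro z σ hσ hσR
  have hp0 : 0 < p := by linarith
  have hp1 : 0 < p - 1 := by linarith
  have hc := heatConst_pos (N := N)
  have hb0 : 0 ≤ b := by rw [hb]; exact div_nonneg (by linarith) hp1.le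
  have hb1 : b < 1 := by rw [hb, div_lt_one hp1]; linarith
  have hc1 : 1 - r / p < 1 := sub_lt_self _ (by positivity)
  have hc0 : 0 < 1 - r / p := by rw [sub_pos, div_lt_one hp0]; exact hrp
  have hhm := measurable_hDensity α
  set D := heatConst N ^ (p - 1) * M ^ p * σ ^ ((N : ℝ) - κ) with hD
  have hD0 : 0 < D := by positivity
  let W : ℝ → ℝ≥0∞ := fun s => ENNReal.ofReal
    (α * ((t - s) ^ (α * (1 - r / p) - 1) * s ^ (-(α * b))) * (K * D ^ (1 / p)))
  have hWm : Measurable W := by fun_prop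
  have hmeas : Measurable (Function.uncurry fun (s : ℝ) (x : EuclideanSpace ℝ (Fin N)) =>
      ENNReal.ofReal (α * (t - s) ^ (α - 1)) *
        subord (fun θ => θ * hDensity α θ) ((t - s) ^ α) (v s) x) := by
    have h3 := measurable_subord (w := fun θ => θ * hDensity α θ) (by fun_prop)
      (τ := fun s : ℝ => (t - s) ^ α) (by fun_prop) hv
    have h4 : Measurable fun q : ℝ × EuclideanSpace ℝ (Fin N) =>
      ENNReal.ofReal (α * (t - q.1) ^ (α - 1)) := by fun_prop
    exact h4.mul h3
  have H := lintegral_lintegral_rpow_le (m := volume.restrict (Ioo (0 : ℝ) t))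
    (ν := volume.restrict (Metric.ball z σ)) (show 1 ≤ p by linarith) hmeas hWm ?_ ?_ ?_
  · have e : ∀ x, duhamel α v t x = ∫⁻ s in Ioo 0 t, ENNReal.ofReal (α * (t - s) ^ (α - 1)) *
        subord (fun θ => θ * hDensity α θ) ((t - s) ^ α) (v s) x := by
      intro x
      unfold duhamel
      rw [← lintegral_const_mul' _ _ ENNReal.ofReal_ne_top]
      simp only [ENNReal.ofReal_mul h0.le, mul_assoc]
    simp only [e]
    refine H.trans ?_
    set B := 2 / (1 - b) + 2 / (1 - r / p) with hB
    have hB0 : 0 < B := by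
      have : 0 < 1 - b := by linarith
      positivity
    -- This identity singles out `b = (p-r)/(p-1)`: the `p`-th power of the Beta integral decays
    -- exactly like the bound assumed on `v`.
    have ee : α * (1 - r / p) - α * b = -(α * b / p) := by
      rw [hb]; field_simp; ring
    have hW : ∫⁻ s in Ioo 0 t, W s ≤ ENNReal.ofReal (B * t ^ (-(α * b / p)) * (K * D ^ (1 / p))) := by
      have hbeta := lintegral_beta_le h0 h1 hb0 hb1 hc0 hc1 ht
      rw [ee] at hbeta
      calc _ = (∫⁻ s in Ioo 0 t, ENNReal.ofReal (α * ((t - s) ^ (α * (1 - r / p) - 1) *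
            s ^ (-(α * b))))) * ENNReal.ofReal (K * D ^ (1 / p)) := by
            rw [← lintegral_mul_const' _ _ ENNReal.ofReal_ne_top]
            refine lintegral_congr fun θ => ?_
            rw [← ENNReal.ofReal_mul' (by positivity)]
        _ ≤ _ := by
            rw [ENNReal.ofReal_mul (p := B * t ^ (-(α * b / p))) (by positivity)]
            gcongr
    calc _ ≤ ENNReal.ofReal (B * t ^ (-(α * b / p)) * (K * D ^ (1 / p))) ^ p := by gcongr
      _ = _ := by
        rw [ENNReal.ofReal_rpow_of_nonneg (by positivity) hp0.le]
        congr 1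
        rw [Real.mul_rpow (by positivity) (by positivity), Real.mul_rpow hB0.le (by positivity),
          Real.mul_rpow hK.le (by positivity), ← Real.rpow_mul hD0.le, one_div,
          inv_mul_cancel₀ hp0.ne', Real.rpow_one, ← Real.rpow_mul ht.le, neg_mul,
          div_mul_cancel₀ _ hp0.ne', hD]
        ring
  · filter_upwards [ae_restrict_mem measurableSet_Ioo] with s hs
    have := hs.1
    have : 0 < t - s := by linarith [hs.2]
    have : 0 < α * ((t - s) ^ (α * (1 - r / p) - 1) * s ^ (-(α * b))) * (K * D ^ (1 / p)) := by
      positivity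
    simpa [W] using this
  · exact Eventually.of_forall fun θ => ENNReal.ofReal_ne_top
  · filter_upwards [ae_restrict_mem measurableSet_Ioo] with s hs
    have hs0 := hs.1
    have hts : 0 < t - s := by linarith [hs.2]
    have hvs : Measurable (v s) := hv.comp measurable_prodMk_left
    have hτ : (t - s) ^ α ≤ R ^ 2 := by
      refine le_trans ?_ htR
      gcongr
      linarith
    -- The source is controlled only in `L^1`, hence exponent `1`; the smoothing loss is then
    -- `κ(p-1)/2 = r`.
    have key := morreyBound_subord (r := 1) (p := p) (d := r) (M := M) (τ := (t - s) ^ α)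
      (w := fun θ => θ * hDensity α θ) (by positivity) hR hτ le_rfl
      (by linarith) (by rw [hκ]; ring) hM (show 0 < K * s ^ (-(α * b)) by positivity) (by fun_prop)
      (fun θ hθ => mul_pos hθ (hDensity_pos h0 h1 hθ)) hwM hvs (by simpa using h s hs) z σ hσ hσR
    simp only [div_one] at key
    calc ∫⁻ x in Metric.ball z σ, (ENNReal.ofReal (α * (t - s) ^ (α - 1)) *
          subord (fun θ => θ * hDensity α θ) ((t - s) ^ α) (v s) x) ^ p
        = ENNReal.ofReal ((α * (t - s) ^ (α - 1)) ^ p) * ∫⁻ x in Metric.ball z σ,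
            subord (fun θ => θ * hDensity α θ) ((t - s) ^ α) (v s) x ^ p := by
          rw [← lintegral_const_mul' _ _ ENNReal.ofReal_ne_top]
          refine lintegral_congr fun x => ?_
          rw [ENNReal.mul_rpow_of_nonneg _ _ hp0.le,
            ENNReal.ofReal_rpow_of_nonneg (by positivity) hp0.le]
      _ ≤ _ := by
          refine (mul_le_mul_right key _).trans_eq ?_
          simp only [W]
          rw [← ENNReal.ofReal_mul (by positivity),
            ENNReal.ofReal_rpow_of_nonneg (by positivity) hp0.le]
          congr 1
          have e3 : (t - s) ^ (α * (1 - r / p) - 1) =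
              (t - s) ^ (α - 1) * ((t - s) ^ α) ^ (-(r / p)) := by
            rw [← Real.rpow_mul hts.le, ← Real.rpow_add hts]
            congr 1
            ring
          have e4 : (((t - s) ^ α) ^ (-(r / p))) ^ p = ((t - s) ^ α) ^ (-r) := by
            rw [← Real.rpow_mul (by positivity), neg_mul, div_mul_cancel₀ _ hp0.ne']
          rw [e3, Real.mul_rpow (y := K * D ^ (1 / p)) (by positivity) (by positivity),
            Real.mul_rpow (x := K) hK.le (by positivity), Real.mul_rpow (x := K) hK.le (by positivity),
            ← Real.rpow_mul hD0.le, one_div, inv_mul_cancel₀ hp0.ne', Real.rpow_one,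
            Real.mul_rpow (x := α) h0.le (by positivity), Real.mul_rpow (x := α) h0.le (by positivity),
            Real.mul_rpow (y := s ^ (-(α * b))) (by positivity) (by positivity),
            Real.mul_rpow (x := (t - s) ^ (α - 1)) (by positivity) (by positivity), e4, hD]
          ring

/-! ### Monotonicity, measurability and monotone convergence -/

lemma heat_mono (t : ℝ) {f g : EuclideanSpace ℝ (Fin N) → ℝ≥0∞} (h : f ≤ g) : heat t f ≤ heat t g :=
  fun _ => lintegral_mono fun y => mul_le_mul_right (h y) _

lemma subord_mono (w : ℝ → ℝ) (τ : ℝ) {f g : EuclideanSpace ℝ (Fin N) → ℝ≥0∞} (h : f ≤ g) :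
    subord w τ f ≤ subord w τ g :=
  fun x => lintegral_mono fun _ => mul_le_mul_right (heat_mono _ h x) _

lemma duhamel_mono (α : ℝ) {v w : ℝ → EuclideanSpace ℝ (Fin N) → ℝ≥0∞} (h : v ≤ w) :
    duhamel α v ≤ duhamel α w :=
  fun _ x => mul_le_mul_right
    (lintegral_mono fun s => mul_le_mul_right (subord_mono _ _ (h s) x) _) _

lemma measurable_heat (x : EuclideanSpace ℝ (Fin N)) {f : EuclideanSpace ℝ (Fin N) → ℝ≥0∞}
    (hf : Measurable f) {A : Type*} [MeasurableSpace A] {τ : A → ℝ} (hτ : Measurable τ) :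
    Measurable fun a => heat (τ a) f x := by
  have hg : Measurable (Function.uncurry fun (_ : A) => f) := hf.comp measurable_snd
  have h : Measurable fun z : A × EuclideanSpace ℝ (Fin N) => heat (τ z.1) f z.2 :=
    measurable_heat_kernel_mul hτ hg
  have hx : Measurable fun a : A => (a, x) := measurable_prodMk_right
  simpa only [Function.comp_def] using h.comp hx

lemma measurable_subord_of_measurable {w : ℝ → ℝ} (hw : Measurable w) (τ : ℝ)
    {f : EuclideanSpace ℝ (Fin N) → ℝ≥0∞} (hf : Measurable f) : Measurable (subord w τ f) := by
  have hg : Measurable (Function.uncurry fun (_ : ℝ) => f) := hf.comp measurable_snd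
  have h : Measurable fun z : ℝ × EuclideanSpace ℝ (Fin N) => subord w τ f z.2 :=
    measurable_subord (τ := fun _ => τ) hw measurable_const hg
  have h0 : Measurable fun x : EuclideanSpace ℝ (Fin N) => ((0 : ℝ), x) := measurable_prodMk_left
  simpa only [Function.comp_def] using h.comp h0

lemma measurable_duhamel (α : ℝ) {v : ℝ → EuclideanSpace ℝ (Fin N) → ℝ≥0∞}
    (hv : Measurable (Function.uncurry v)) : Measurable (Function.uncurry (duhamel α v)) := by
  have hhm := measurable_hDensity α
  have hS : MeasurableSet {q : (ℝ × EuclideanSpace ℝ (Fin N)) × ℝ | q.2 ∈ Ioo 0 q.1.1} := by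
    simp only [mem_Ioo, ofPred_and]
    exact (measurableSet_lt measurable_const (by fun_prop)).inter
      (measurableSet_lt (by fun_prop) (by fun_prop))
  have h1 := measurable_subord (A := ℝ × ℝ) (w := fun θ => θ * hDensity α θ) (by fun_prop)
    (τ := fun a => (a.1 - a.2) ^ α) (by fun_prop) (g := fun a => v a.2)
    (hv.comp (g := Function.uncurry v)
      (f := fun z : (ℝ × ℝ) × EuclideanSpace ℝ (Fin N) => (z.1.2, z.2)) (by fun_prop))
  have h2 := h1.comp (f := fun z : (ℝ × EuclideanSpace ℝ (Fin N)) × ℝ => ((z.1.1, z.2), z.1.2))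
    (by fun_prop)
  have h3 : Measurable fun z : (ℝ × EuclideanSpace ℝ (Fin N)) × ℝ =>
      ENNReal.ofReal ((z.1.1 - z.2) ^ (α - 1)) := by fun_prop
  have h4 := ((h3.mul h2).indicator hS).lintegral_prod_right' (ν := volume)
  have e : Function.uncurry (duhamel α v) = fun z => ENNReal.ofReal α *
      ∫⁻ s, indicator {q : (ℝ × EuclideanSpace ℝ (Fin N)) × ℝ | q.2 ∈ Ioo 0 q.1.1}
        (fun q => ENNReal.ofReal ((q.1.1 - q.2) ^ (α - 1)) *
          subord (fun θ => θ * hDensity α θ) ((q.1.1 - q.2) ^ α) (v q.2) q.1.2) (z, s) := by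
    funext z
    simp only [Function.uncurry, duhamel]
    rw [← lintegral_indicator measurableSet_Ioo]
    rfl
  rw [e]
  exact h4.const_mul _

lemma heat_iSup (t : ℝ) {f : ℕ → EuclideanSpace ℝ (Fin N) → ℝ≥0∞} (hf : ∀ n, Measurable (f n))
    (hmono : Monotone f) (x : EuclideanSpace ℝ (Fin N)) :
    heat t (fun y => ⨆ n, f n y) x = ⨆ n, heat t (f n) x := by
  unfold heat
  simp only [ENNReal.mul_iSup]
  exact lintegral_iSup (fun n => (measurable_heatKernel_sub t x).mul (hf n))
    fun m n h y => mul_le_mul_right (hmono h y) _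

lemma subord_iSup {w : ℝ → ℝ} (hw : Measurable w) (τ : ℝ)
    {f : ℕ → EuclideanSpace ℝ (Fin N) → ℝ≥0∞} (hf : ∀ n, Measurable (f n))
    (hmono : Monotone f) (x : EuclideanSpace ℝ (Fin N)) :
    subord w τ (fun y => ⨆ n, f n y) x = ⨆ n, subord w τ (f n) x := by
  unfold subord
  simp only [heat_iSup _ hf hmono, ENNReal.mul_iSup]
  refine lintegral_iSup (fun n => ?_) fun m n h θ => mul_le_mul_right (heat_mono _ (hmono h) x) _
  exact (Measurable.ennreal_ofReal hw).mul (measurable_heat x (hf n) (by fun_prop))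

lemma duhamel_iSup (α : ℝ) {v : ℕ → ℝ → EuclideanSpace ℝ (Fin N) → ℝ≥0∞}
    (hv : ∀ n, Measurable (Function.uncurry (v n))) (hmono : Monotone v) (t : ℝ)
    (x : EuclideanSpace ℝ (Fin N)) :
    duhamel α (fun s y => ⨆ n, v n s y) t x = ⨆ n, duhamel α (v n) t x := by
  have hhm := measurable_hDensity α
  have hvs : ∀ n s, Measurable (v n s) := fun n s => (hv n).comp measurable_prodMk_left
  unfold duhamel
  rw [← ENNReal.mul_iSup]
  congr 1
  have e : ∀ s, subord (fun θ => θ * hDensity α θ) ((t - s) ^ α) (fun y => ⨆ n, v n s y) x =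
      ⨆ n, subord (fun θ => θ * hDensity α θ) ((t - s) ^ α) (v n s) x := fun s =>
    subord_iSup (by fun_prop) _ (fun n => hvs n s) (fun m n h => hmono h s) x
  simp only [e, ENNReal.mul_iSup]
  refine lintegral_iSup (fun n => ?_)
    fun m n h s => mul_le_mul_right (subord_mono _ _ (hmono h s) x) _
  have h1 := (measurable_subord (w := fun θ => θ * hDensity α θ) (by fun_prop)
    (τ := fun s : ℝ => (t - s) ^ α) (by fun_prop) (hv n)).comp
      (measurable_prodMk_right (y := x))
  have h3 : Measurable fun s : ℝ => ENNReal.ofReal ((t - s) ^ (α - 1)) := by fun_prop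
  exact h3.mul h1

/-! ### Picard iteration -/

/-- The Picard iterates for `∂_t^α u - Δu = u^p`, `u(0) = f`. -/
noncomputable def picard (α p : ℝ) (f : EuclideanSpace ℝ (Fin N) → ℝ≥0∞) :
    ℕ → ℝ → EuclideanSpace ℝ (Fin N) → ℝ≥0∞
  | 0 => fun _ _ => 0
  | n + 1 => fun t x => subord (hDensity α) (t ^ α) f x +
      duhamel α (fun s y => picard α p f n s y ^ p) t x

lemma measurable_picard (α p : ℝ) {f : EuclideanSpace ℝ (Fin N) → ℝ≥0∞} (hf : Measurable f)
    (n : ℕ) : Measurable (Function.uncurry (picard α p f n)) := by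
  induction n with
  | zero => exact measurable_const
  | succ n ih =>
    have h1 := measurable_subord (measurable_hDensity α) (τ := fun t : ℝ => t ^ α) (by fun_prop)
      (g := fun _ => f) (hf.comp measurable_snd)
    exact h1.add (measurable_duhamel α (ih.pow_const p))

lemma monotone_picard (α : ℝ) {p : ℝ} (hp : 0 ≤ p) (f : EuclideanSpace ℝ (Fin N) → ℝ≥0∞) :
    Monotone (picard α p f) := by
  refine monotone_nat_of_le_succ fun n => ?_
  induction n with
  | zero => exact fun t x => zero_le
  | succ n ih =>
    intro t x
    simp only [picard]
    gcongr
    exact duhamel_mono α (fun s y => ENNReal.rpow_le_rpow (ih s y) hp) t x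

/-- The iterates increase, so monotone convergence passes the supremum through every integral. The
identity holds pointwise in `[0,∞]`, before anything is known about finiteness. -/
lemma iSup_picard_eq (α : ℝ) {p : ℝ} (hp : 0 < p) {f : EuclideanSpace ℝ (Fin N) → ℝ≥0∞}
    (hf : Measurable f) (t : ℝ) (x : EuclideanSpace ℝ (Fin N)) :
    ⨆ n, picard α p f n t x = subord (hDensity α) (t ^ α) f x +
      duhamel α (fun s y => (⨆ n, picard α p f n s y) ^ p) t x := by
  have hmono := monotone_picard α hp.le f
  have e : (fun (s : ℝ) (y : EuclideanSpace ℝ (Fin N)) => (⨆ n, picard α p f n s y) ^ p) =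
      fun s y => ⨆ n, picard α p f n s y ^ p := by
    funext s y
    exact (ENNReal.orderIsoRpow p hp).map_iSup _
  rw [e, duhamel_iSup α (fun n => (measurable_picard α p hf n).pow_const p)
    (fun m n h s y => ENNReal.rpow_le_rpow (hmono h s y) hp.le), ENNReal.add_iSup]
  have h2 : Monotone fun n => picard α p f n t x := fun m n h => hmono h t x
  -- Dropping the zeroth iterate does not change the supremum, and every later one unfolds by the
  -- recursion.
  rw [← h2.iSup_nat_add 1]
  rfl

/-! ### The a priori bound and existence -/

lemma morreyBound_add_rpow {R κ A B p : ℝ} (hp : 1 ≤ p) (hA : 0 ≤ A) (hB : 0 ≤ B)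
    {f g : EuclideanSpace ℝ (Fin N) → ℝ≥0∞} (hf : Measurable f)
    (hfA : MorreyBound (fun x => f x ^ p) R κ A) (hgB : MorreyBound (fun x => g x ^ p) R κ B) :
    MorreyBound (fun x => (f x + g x) ^ p) R κ (2 ^ (p - 1) * (A + B)) := by
  intro z σ hσ hσR
  calc _ ≤ ∫⁻ y in Metric.ball z σ, ENNReal.ofReal (2 ^ (p - 1)) * (f y ^ p + g y ^ p) := by
        refine lintegral_mono fun y => ?_
        rw [← ENNReal.ofReal_rpow_of_nonneg zero_le_two (by linarith)]
        simpa using ENNReal.rpow_add_le_mul_rpow_add_rpow (f y) (g y) hp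
    _ = ENNReal.ofReal (2 ^ (p - 1)) * ((∫⁻ y in Metric.ball z σ, f y ^ p) +
          ∫⁻ y in Metric.ball z σ, g y ^ p) := by
        rw [lintegral_const_mul' _ _ ENNReal.ofReal_ne_top, lintegral_add_left (hf.pow_const p)]
    _ ≤ ENNReal.ofReal (2 ^ (p - 1)) * (ENNReal.ofReal (A * σ ^ ((N : ℝ) - κ)) +
          ENNReal.ofReal (B * σ ^ ((N : ℝ) - κ))) := by
        gcongr
        · exact hfA z σ hσ hσR
        · exact hgB z σ hσ hσR
    _ = _ := by
        rw [← ENNReal.ofReal_add (by positivity) (by positivity),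
          ← ENNReal.ofReal_mul (by positivity)]
        congr 1
        ring

lemma MorreyBound.mono {R κ A B : ℝ} {f : EuclideanSpace ℝ (Fin N) → ℝ≥0∞}
    (h : MorreyBound f R κ A) (hAB : A ≤ B) : MorreyBound f R κ B := fun z σ hσ hσR =>
  (h z σ hσ hσR).trans (ENNReal.ofReal_le_ofReal (by gcongr))

/-- Balls of radius `R` carry a finite integral of `f^p`, so the set where `f` is infinite is
locally null, hence null. -/
lemma ae_lt_top_of_morreyBound {R κ A p : ℝ} (hR : 0 < R) (hp : 0 < p)
    {f : EuclideanSpace ℝ (Fin N) → ℝ≥0∞} (hf : Measurable f)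
    (h : MorreyBound (fun x => f x ^ p) R κ A) : ∀ᵐ x, f x < ∞ := by
  refine measure_null_of_locally_null _ fun x _ =>
    ⟨_, inter_mem_nhdsWithin _ (Metric.ball_mem_nhds x hR), ?_⟩
  have h1 := ae_lt_top (hf.pow_const p) ((h x R hR le_rfl).trans_lt ENNReal.ofReal_lt_top).ne
  rw [ae_restrict_iff' Metric.isOpen_ball.measurableSet] at h1
  refine measure_mono_null (t := {y | y ∈ Metric.ball x R → f y ^ p < ∞}ᶜ)
    (fun y hy hcon => hy.1 ?_) h1
  have hcon : y ∈ Metric.ball x R → f y ^ p < ∞ := hcon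
  simpa [ENNReal.rpow_lt_top_iff_of_pos hp] using hcon hy.2

/-- Existence for initial data small in a Morrey norm, uniformly in `α` and `T`. -/
lemma exists_isSolution_of_morreyBound {κ r p : ℝ} (hr : 1 < r) (hrp : r < p)
    (hκ : κ * (p - 1) = 2 * r) :
    ∃ A : ℝ, 0 < A ∧ ∀ α T : ℝ, 0 < α → α < 1 → 0 < T →
      ∀ f : EuclideanSpace ℝ (Fin N) → ℝ≥0∞, Measurable f →
        MorreyBound (fun x => f x ^ r) (T ^ (α / 2)) κ A →
          ∃ u, IsSolution α p T (volume.withDensity f) u := by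
  have hp0 : 0 < p := by linarith
  have hr0 : 0 < r := by linarith
  have hp1 : 0 < p - 1 := by linarith
  have hc := heatConst_pos (N := N)
  set b := (p - r) / (p - 1) with hb
  have hb0 : 0 < b := div_pos (by linarith) hp1
  have hb1 : b < 1 := by rw [hb, div_lt_one hp1]; linarith
  have hrp1 : r / p < 1 := by rwa [div_lt_one hp0]
  -- `M₁` and `M₂` are fixed before `α`; `h_α` enters the constants only through them.
  obtain ⟨M₁, hM₁, hP⟩ := exists_hDensity_mul_min_rpow_le (b := b / p) (by positivity)
    (by rw [div_lt_one hp0]; linarith)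
  obtain ⟨M₂, hM₂, hS⟩ := exists_mul_hDensity_mul_min_rpow_le hrp1
  set C₁ := 2 ^ (p - 1) * (heatConst N ^ ((p - r) / r) * M₁ ^ p) with hC₁
  set C₂ := 2 ^ (p - 1) * (heatConst N ^ (p - 1) * M₂ ^ p *
    (2 / (1 - b) + 2 / (1 - r / p)) ^ p) with hC₂
  have hC₁0 : 0 < C₁ := by positivity
  have hC₂0 : 0 < C₂ := by
    have : 0 < 1 - b := by linarith
    have : 0 < 1 - r / p := by linarith
    positivity
  -- `K` solves `C₂ K^p = K/2`, and below `A` solves `C₁ A^(p/r) = K/2`, so the linear and Duhamel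
  -- contributions add up to exactly `K`.
  set K := (1 / (2 * C₂)) ^ (1 / (p - 1)) with hK
  have hK0 : 0 < K := by positivity
  have hKp : C₂ * K ^ p = K / 2 := by
    have : K ^ (p - 1) = 1 / (2 * C₂) := by
      rw [hK, ← Real.rpow_mul (by positivity), one_div_mul_cancel hp1.ne', Real.rpow_one]
    rw [show p = (p - 1) + 1 by ring, Real.rpow_add_one hK0.ne', this]
    field_simp
  set A := (K / (2 * C₁)) ^ (r / p) with hA
  have hA0 : 0 < A := by positivity
  have hAp : C₁ * A ^ (p / r) = K / 2 := by
    rw [hA, ← Real.rpow_mul (by positivity), show r / p * (p / r) = 1 by field_simp, Real.rpow_one]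
    field_simp
  refine ⟨A, hA0, fun α T h0 h1 hT f hf hfA => ?_⟩
  set R := T ^ (α / 2) with hR
  have hR0 : 0 < R := by positivity
  have hR2 : R ^ 2 = T ^ α := by
    rw [hR, ← Real.rpow_natCast, ← Real.rpow_mul hT.le]; congr 1; push_cast; ring
  have hbound : ∀ n, ∀ t ∈ Ioc 0 T,
      MorreyBound (fun x => picard α p f n t x ^ p) R κ (K * t ^ (-(α * b))) := by
    intro n
    induction n with
    | zero =>
      intro t _ z σ _ _
      simp [picard, ENNReal.zero_rpow_of_pos hp0]
    | succ n ih =>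
      intro t ht
      have ht0 := ht.1
      have htR : t ^ α ≤ R ^ 2 := by
        rw [hR2]
        exact Real.rpow_le_rpow ht0.le ht.2 h0.le
      have m1 := morreyBound_subord (p := p) (d := b) (M := M₁) (τ := t ^ α) (by positivity) hR0 htR
        -- The smoothing exponent of the linear term is also `b`, since `κ = 2r/(p-1)` gives
        -- `κ(p-r)/(2r) = (p-r)/(p-1)`.
        hr.le hrp.le (by
          rw [hb, div_eq_div_iff hp1.ne' (by positivity)]
          linear_combination (r - p) * hκ) hM₁ hA0
        (measurable_hDensity α) (fun θ hθ => hDensity_pos h0 h1 hθ) (hP α h0 h1) hf hfA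
      have m2 := morreyBound_duhamel h0 h1 ht0 hR0 htR hr hrp hκ hb hM₂ hK0 (hS α h0 h1)
        ((measurable_picard α p hf n).pow_const p) (fun s hs => ih s ⟨hs.1, hs.2.le.trans ht.2⟩)
      have hms := measurable_subord_of_measurable (measurable_hDensity α) (t ^ α) hf
      have h1b : 0 < 1 - b := by linarith
      have h1r : 0 < 1 - r / p := by linarith
      have m3 := morreyBound_add_rpow (f := fun x => subord (hDensity α) (t ^ α) f x)
        (g := fun x => duhamel α (fun s y => picard α p f n s y ^ p) t x)
        (by linarith) (by positivity) (by positivity) hms m1 m2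
      refine MorreyBound.mono m3 (le_of_eq ?_)
      rw [← Real.rpow_mul ht0.le, mul_neg]
      calc _ = (C₁ * A ^ (p / r) + C₂ * K ^ p) * t ^ (-(α * b)) := by rw [hC₁, hC₂]; ring
        _ = _ := by rw [hAp, hKp]; ring
  refine ⟨fun t x => ⨆ n, picard α p f n t x, ?_, ?_⟩
  · exact Measurable.iSup fun n => measurable_picard α p hf n
  have hum : Measurable (Function.uncurry fun (t : ℝ) (x : EuclideanSpace ℝ (Fin N)) =>
      ⨆ n, picard α p f n t x) := Measurable.iSup fun n => measurable_picard α p hf n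
  have hu : ∀ t ∈ Ioc 0 T,
      MorreyBound (fun x => (⨆ n, picard α p f n t x) ^ p) R κ (K * t ^ (-(α * b))) := by
    intro t ht z σ hσ hσR
    have e : ∀ y, (⨆ n, picard α p f n t y) ^ p = ⨆ n, picard α p f n t y ^ p := fun y =>
      (ENNReal.orderIsoRpow p hp0).map_iSup _
    simp only [e]
    have hm : ∀ n, Measurable fun y => picard α p f n t y ^ p := fun n =>
      ((measurable_picard α p hf n).comp (measurable_prodMk_left (x := t))).pow_const p
    rw [lintegral_iSup hm
      (fun m n h y => ENNReal.rpow_le_rpow (monotone_picard α hp0.le f h t y) hp0.le)]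
    exact iSup_le fun n => hbound n t ht z σ hσ hσR
  have hfin : ∀ᵐ z : ℝ × EuclideanSpace ℝ (Fin N) ∂((volume.restrict (Ioc 0 T)).prod volume),
      ⨆ n, picard α p f n z.1 z.2 < ∞ := by
    refine (Measure.ae_prod_iff_ae_ae (measurableSet_lt hum measurable_const)).2 ?_
    filter_upwards [ae_restrict_mem measurableSet_Ioc] with t ht
    exact ae_lt_top_of_morreyBound hR0 hp0 (hum.comp measurable_prodMk_left) (hu t ht)
  filter_upwards [hfin] with z hz
  refine ⟨hz, ?_⟩
  rw [iSup_picard_eq α hp0 hf, opP_withDensity α _ hf]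
  congr 1
  simp only [duhamel]
  congr 1
  refine lintegral_congr fun s => ?_
  rw [opS_withDensity]
  exact (hum.comp (measurable_prodMk_left (x := s))).pow_const p

/-! ### Reduction to `r < p` and the theorem -/

/-- Hölder's inequality on balls. -/
lemma morreyBound_of_rpow {R lam r r' γ : ℝ} (hr' : 1 ≤ r') (hrr' : r' ≤ r) (hγ : 0 < γ)
    {f : EuclideanSpace ℝ (Fin N) → ℝ≥0∞} (hf : Measurable f)
    (h : ∀ (z : EuclideanSpace ℝ (Fin N)) (σ : ℝ), 0 < σ → σ ≤ R →
      (∫⁻ y in Metric.ball z σ, f y ^ r) ^ (1 / r) ≤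
        ENNReal.ofReal (γ * σ ^ ((N : ℝ) / r - lam))) :
    MorreyBound (fun y => f y ^ r') R (lam * r')
      ((volume (Metric.ball (0 : EuclideanSpace ℝ (Fin N)) 1)).toReal ^ (1 - r' / r) *
        γ ^ r') := by
  intro z σ hσ hσR
  have hr'0 : 0 < r' := by linarith
  have hr0 : 0 < r := by linarith
  have hv := toReal_volume_ball_pos (N := N)
  set ω := (volume (Metric.ball (0 : EuclideanSpace ℝ (Fin N)) 1)).toReal
  have hq : 1 ≤ r / r' := by rwa [one_le_div hr'0]
  -- With weight `1` and exponent `r/r'`, the weighted Jensen inequality is Hölder's, and the total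
  -- weight is the volume of the ball.
  have H := lintegral_rpow_le_weighted (m := volume.restrict (Metric.ball z σ)) hq
    (hf.pow_const r').aemeasurable (W := fun _ => 1) aemeasurable_const (by simp) (by simp)
  simp only [lintegral_const, Measure.restrict_apply_univ, one_mul, ENNReal.one_rpow,
    ← ENNReal.rpow_mul, mul_div_cancel₀ r hr'0.ne', volume_ball_eq_ofReal hσ] at H
  have h2 : ∫⁻ y in Metric.ball z σ, f y ^ r ≤
      ENNReal.ofReal ((γ * σ ^ ((N : ℝ) / r - lam)) ^ r) := by
    rw [← ENNReal.ofReal_rpow_of_nonneg (by positivity) hr0.le]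
    have := ENNReal.rpow_le_rpow (h z σ hσ hσR) hr0.le
    rwa [← ENNReal.rpow_mul, one_div_mul_cancel hr0.ne', ENNReal.rpow_one] at this
  calc ∫⁻ y in Metric.ball z σ, f y ^ r'
      = ((∫⁻ y in Metric.ball z σ, f y ^ r') ^ (r / r')) ^ (r' / r) := by
        rw [← ENNReal.rpow_mul, show r / r' * (r' / r) = 1 by field_simp, ENNReal.rpow_one]
    _ ≤ (ENNReal.ofReal (σ ^ (N : ℝ) * ω) ^ (r / r' - 1) *
          ENNReal.ofReal ((γ * σ ^ ((N : ℝ) / r - lam)) ^ r)) ^ (r' / r) := by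
        refine ENNReal.rpow_le_rpow (H.trans ?_) (by positivity)
        gcongr
    _ = _ := by
        rw [ENNReal.ofReal_rpow_of_nonneg (by positivity) (by linarith),
          ← ENNReal.ofReal_mul (by positivity),
          ENNReal.ofReal_rpow_of_nonneg (by positivity) (by positivity)]
        congr 1
        rw [Real.mul_rpow (by positivity) (by positivity), ← Real.rpow_mul (by positivity),
          ← Real.rpow_mul (by positivity), mul_div_cancel₀ _ hr0.ne',
          show (r / r' - 1) * (r' / r) = 1 - r' / r by field_simp,
          Real.mul_rpow (by positivity) hv.le, Real.mul_rpow hγ.le (by positivity),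
          ← Real.rpow_mul hσ.le, ← Real.rpow_mul hσ.le,
          show (N : ℝ) - lam * r' = N * (1 - r' / r) + (N / r - lam) * r' by field_simp; ring,
          Real.rpow_add hσ]
        ring

end TimeFractional

open TimeFractional in
theorem theorem1p3 (N : ℕ) (hN : 1 ≤ N) (p r : ℝ) (hp : 1 + 2 / (N : ℝ) < p) (hr : 1 < r)
    (hpr : 2 * r / (p - 1) < (N : ℝ)) :
    ∃ γ : ℝ → ℝ,
      (∀ α : ℝ, 0 < α → α < 1 →
        0 < γ α ∧
        ∀ T : ℝ, 0 < T →
        ∀ μ : EuclideanSpace ℝ (Fin N) → ℝ, AEMeasurable μ volume → (∀ x, 0 ≤ μ x) →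
          (∀ σ : ℝ, 0 < σ → σ ≤ T ^ (α / 2) →
            ⨆ z : EuclideanSpace ℝ (Fin N),
                (∫⁻ y in Metric.ball z σ, ENNReal.ofReal (μ y ^ r)) ^ (1 / r) ≤
              ENNReal.ofReal (γ α * σ ^ ((N : ℝ) / r - 2 / (p - 1)))) →
          ∃ u : ℝ → EuclideanSpace ℝ (Fin N) → ℝ≥0∞,
            TimeFractional.IsSolution α p T
              (volume.withDensity fun y => ENNReal.ofReal (μ y)) u) ∧
      0 < limsup (fun α : ℝ => (γ α : EReal)) (𝓝[<] 1) ∧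
      limsup (fun α : ℝ => (γ α : EReal)) (𝓝[<] 1) < ⊤ := by
  have hN0 : (0 : ℝ) < N := by exact_mod_cast hN
  have hp1 : 1 < p := by
    have : 0 < 2 / (N : ℝ) := by positivity
    linarith
  have hp1' : 0 < p - 1 := by linarith
  -- The existence lemma needs an exponent strictly between `1` and `p`, while `r` may exceed `p`;
  -- the midpoint `(1+p)/2` serves in that case.
  set q := min r ((1 + p) / 2) with hq
  have hq1 : 1 < q := lt_min hr (by linarith)
  have hqp : q < p := (min_le_right _ _).trans_lt (by linarith)
  have hqr : q ≤ r := min_le_left _ _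
  obtain ⟨A, hA, hex⟩ := exists_isSolution_of_morreyBound (N := N) (κ := 2 / (p - 1) * q) hq1 hqp
    (by field_simp)
  have hω := toReal_volume_ball_pos (N := N)
  set ω := (volume (Metric.ball (0 : EuclideanSpace ℝ (Fin N)) 1)).toReal with hωdef
  -- Chosen so that the constant produced by Hölder's inequality is exactly `A`.
  set γ := (A / ω ^ (1 - q / r)) ^ (1 / q) with hγ
  have hγ0 : 0 < γ := by positivity
  have hγA : ω ^ (1 - q / r) * γ ^ q = A := by
    rw [hγ, ← Real.rpow_mul (by positivity), one_div_mul_cancel (by linarith), Real.rpow_one]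
    field_simp
  refine ⟨fun _ => γ, fun α h0 h1 => ⟨hγ0, fun T hT μ hμ hμ0 h => ?_⟩, ?_, ?_⟩
  -- A Borel representative of `μ` gives the same measure and the same ball integrals.
  · have hae : (fun y => ENNReal.ofReal (μ y)) =ᵐ[volume] fun y => ENNReal.ofReal (hμ.mk μ y) :=
      hμ.ae_eq_mk.fun_comp ENNReal.ofReal
    rw [withDensity_congr_ae hae]
    refine hex α T h0 h1 hT _ hμ.measurable_mk.ennreal_ofReal ?_
    rw [← hγA]
    refine morreyBound_of_rpow hq1.le hqr hγ0 hμ.measurable_mk.ennreal_ofReal fun z σ hσ hσR => ?_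
    have e : ∫⁻ y in Metric.ball z σ, ENNReal.ofReal (hμ.mk μ y) ^ r =
        ∫⁻ y in Metric.ball z σ, ENNReal.ofReal (μ y ^ r) := by
      refine lintegral_congr_ae (ae_restrict_of_ae ?_)
      filter_upwards [hae] with y hy
      rw [← hy, ENNReal.ofReal_rpow_of_nonneg (hμ0 y) (by linarith)]
    rw [e]
    exact (le_iSup (fun z => (∫⁻ y in Metric.ball z σ, ENNReal.ofReal (μ y ^ r)) ^ (1 / r)) z).trans
      (h σ hσ hσR)
  · rw [limsup_const]
    exact_mod_cast hγ0
  · rw [limsup_const]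
    exact EReal.coe_lt_top γ
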